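/- Let $\mathcal{X}=\{1,2,\dots\}$, let $Q$ be a probability distribution on $\mathcal{X}$ with decreasing rearrangement $Q^{\downarrow}(1)\ge Q^{\downarrow}(2)\ge\cdots$, let $\mathcal{Y}$ be a measurable space, $L\ge 1$ an integer and $\varepsilon$ a real number. For a pair $(X,Y)$ of $\mathcal{X}$- and $\mathcal{Y}$-valued random variables let $$P_{\mathrm e}^{(L)}(X\mid Y)=\min_{f}\mathbb{P}\{X\notin f(Y)\},$$ where $f$ runs over the measurable maps from $\mathcal{Y}$ to the nonempty subsets of $\mathcal{X}$ with at most $L$ elements. Suppose that $$1-\sum_{x=1}^{\#(\mathcal{Y})L}Q^{\downarrow}(x)\ \le\ \varepsilon\ \le\ 1-\sum_{x=1}^{L}Q^{\downarrow}(x),$$ where $\#(\mathcal{Y})$ is the number of elements of $\mathcal{Y}$ ($\infty$ if $\mathcal{Y}$ is infinite). Put $$\mathcal{V}(j)=\frac{(1-\varepsilon)-\sum_{x=1}^{j-1}Q^{\downarrow}(x)}{L-j+1}\ \ (1\le j\le L),\qquad \mathcal{V}(j)=1\ \ (j>L),$$ $$\mathcal{W}(L)=-1,\qquad \mathcal{W}(k)=\frac{\sum_{x=1}^{k}Q^{\downarrow}(x)-(1-\varepsilon)}{k-L}\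 \ (L<k<\infty),\qquad \mathcal{W}(\infty)=0,$$ $J=\min\{1\le j<\infty: Q^{\downarrow}(j)<\mathcal{V}(j)\}$ and $K_1=\sup\{L\le k<\infty:\mathcal{W}(k)<Q^{\downarrow}(k)\}\in\{L,L+1,\dots,\infty\}$. The type-1 Fano distribution $P_1$ is defined by $P_1(x)=Q^{\downarrow}(x)$ if $x<J$ or $x>K_1$, $P_1(x)=\mathcal{V}(J)$ if $J\le x\le L$, and $P_1(x)=\mathcal{W}(K_1)$ if $L<x\le K_1$. It is a probability distribution on $\mathcal{X}$. For $\alpha\in(0,1)\cup(1,\infty)$ let $\|P\|_\alpha=\big(\sum_x P(x)^\alpha\big)^{1/\alpha}$, and let $$H_\alpha(P)=\tfrac{1}{1-\alpha}\log\sum_x P(x)^\alpha,\quad H_\alpha^{\mathrm A}(X\mid Y)=\tfrac{\alpha}{1-\alpha}\log\mathbb{E}\big[\|P_{X|Y}\|_\alpha\big],\quad H_\alpha^{\mathrm H}(X\mid Y)=\tfrac{1}{1-\alpha}\log\mathbb{E}\big[\|P_{X|Y}\|_\alpha^\alpha\big]$$ be the Rényi entropy and Arimoto's and Hayashi's conditional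 Rényi entropies, where $P_{X|Y}$ is the regular conditional distribution of $X$ given $Y$. Let $\eta(u)=-u\log u$ with $\eta(0)=0$, let $H_1(P)=H(P)=\sum_x\eta(P(x))$ and $H_1^{\mathrm A}(X\mid Y)=H_1^{\mathrm H}(X\mid Y)=H(X\mid Y)=\mathbb{E}[H(P_{X|Y})]$. All these quantities may be $+\infty$. Then for each $\dagger\in\{\mathrm A,\mathrm H\}$ and each $\alpha\in(0,\infty)$, $$\sup_{(X,Y):\ P_{\mathrm e}^{(L)}(X\mid Y)\le\varepsilon,\ P_X=Q}H_\alpha^{\dagger}(X\mid Y)\ \le\ H_\alpha(P_1),$$ and, with the convention $\infty\cdot 0=0$ (and the term with the factor $K_1-L$ read as $0$ if $K_1=L$), $$H_\alpha(P_1)=\frac{1}{1-\alpha}\log\Big((L-J+1)\,\mathcal{V}(J)^\alpha+(K_1-L)\,\mathcal{W}(K_1)^\alpha+\sum_{x<J\text{ or }x>K_1}Q^{\downarrow}(x)^\alpha\Big)\quad(\alpha\ne1),$$ $$H_1(P_1)=(L-J+1)\,\eta(\mathcal{V}(J))+(K_1-L)\,\eta(\mathcal{W}(K_1))+\sum_{x<J\text{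 or }x>K_1}\eta(Q^{\downarrow}(x)).$$ In particular, for $\alpha=1$ and $L=1$ this yields the Ho–Verdú–Fano inequality: all $\mathcal{X}$-valued random variables $X,Y$ with $\mathbb{P}\{X\ne Y\}\le\varepsilon$ and $P_X=Q$ satisfy $$H(X\mid Y)\ \le\ \eta(1-\varepsilon)+(K_1-1)\,\eta(\mathcal{W}(K_1))+\sum_{x>K_1}\eta(Q^{\downarrow}(x)),$$ with the same conventions. -/

import Mathlib

open MeasureTheory ProbabilityTheory
open scoped ENNReal

noncomputable section

namespace FanoRenyi

/-- The alphabet `{1, 2, …}` carries the discrete σ-algebra. -/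
instance : MeasurableSpace ℕ+ := ⊤

instance : DiscreteMeasurableSpace ℕ+ := ⟨fun _ => trivial⟩

/-- `decr Q n` is the `n`-th largest mass (counted with multiplicity, `n ≥ 1`) of the probability
distribution `Q` on `{1, 2, …}`: the least `t ≥ 0` such that fewer than `n` of the masses exceed
`t`. So `decr Q 1 ≥ decr Q 2 ≥ ⋯` is the decreasing rearrangement of `Q`. The index `0` is not
used. -/
def decr (Q : PMF ℕ+) (n : ℕ) : ℝ :=
  sInf {t : ℝ | 0 ≤ t ∧ {x : ℕ+ | t < (Q x).toReal}.encard < (n : ℕ∞)}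

/-- The weight `V(j)`, for `j ≥ 1`. -/
def weightV (Q : PMF ℕ+) (L : ℕ) (ε : ℝ) (j : ℕ) : ℝ :=
  if j ≤ L then ((1 - ε) - ∑ x ∈ Finset.Ico 1 j, decr Q x) / ((L : ℝ) - (j : ℝ) + 1) else 1

/-- The weight `W(k)`, for `L ≤ k ≤ ∞`. -/
def weightW (Q : PMF ℕ+) (L : ℕ) (ε : ℝ) (k : ℕ∞) : ℝ :=
  if k = ⊤ then 0
  else if k = (L : ℕ∞) then -1
  else (∑ x ∈ Finset.Icc 1 k.toNat, decr Q x - (1 - ε)) / ((k.toNat : ℝ) - (L : ℝ))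

/-- The integer `J = min {1 ≤ j < ∞ | Q↓(j) < V(j)}`. -/
def indexJ (Q : PMF ℕ+) (L : ℕ) (ε : ℝ) : ℕ :=
  sInf {j : ℕ | 1 ≤ j ∧ decr Q j < weightV Q L ε j}

/-- `K = sup {L ≤ k < ∞ | W(k) < Q↓(k)}`, possibly `∞`. -/
def indexK (Q : PMF ℕ+) (L : ℕ) (ε : ℝ) : ℕ∞ :=
  sSup {m : ℕ∞ | ∃ k : ℕ, m = (k : ℕ∞) ∧ L ≤ k ∧ weightW Q L ε (k : ℕ∞) < decr Q k}

/-- The Fano-distribution of type 1. -/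
def fanoType1 (Q : PMF ℕ+) (L : ℕ) (ε : ℝ) (x : ℕ+) : ℝ :=
  if (x : ℕ) < indexJ Q L ε ∨ indexK Q L ε < ((x : ℕ) : ℕ∞) then decr Q (x : ℕ)
  else if (x : ℕ) ≤ L then weightV Q L ε (indexJ Q L ε)
  else weightW Q L ε (indexK Q L ε)

/-- The Shannon entropy `∑ₓ P(x) log (1 / P(x)) ∈ [0, ∞]` (`0 log (1/0) = 0`, natural logarithm);
`Real.negMulLog u = -u log u`. -/
def shannon (P : ℕ+ → ℝ) : ℝ≥0∞ := ∑' x, ENNReal.ofReal (Real.negMulLog (P x))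

/-- `∑ₓ P(x)^α ∈ [0, ∞]`. -/
def powerSum (α : ℝ) (P : ℕ+ → ℝ) : ℝ≥0∞ := ∑' x, ENNReal.ofReal (P x) ^ α

/-- The `ℓ_α`-norm `(∑ₓ P(x)^α)^(1/α) ∈ [0, ∞]`. -/
def alphaNorm (α : ℝ) (P : ℕ+ → ℝ) : ℝ≥0∞ := powerSum α P ^ (1 / α)

/-- The Rényi entropy of order `α`, equal to the Shannon entropy if `α = 1`. -/
def renyi (α : ℝ) (P : ℕ+ → ℝ) : EReal :=
  if α = 1 then ((shannon P : ℝ≥0∞) : EReal)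
  else ((1 / (1 - α) : ℝ) : EReal) * ENNReal.log (powerSum α P)

section Conditional

variable {Ω 𝒴 : Type*} [MeasurableSpace Ω] [MeasurableSpace 𝒴]

/-- The random distribution `P_{X|Y}` (regular conditional distribution of `X` given `Y`). -/
def condLaw (μ : Measure Ω) [IsFiniteMeasure μ] (X : Ω → ℕ+) (Y : Ω → 𝒴) (ω : Ω) (x : ℕ+) : ℝ :=
  (condDistrib X Y μ (Y ω)).real {x}

/-- The conditional Shannon entropy `H(X | Y) = 𝔼[H(P_{X|Y})]`. -/
def condShannon (μ : Measure Ω) [IsFiniteMeasure μ] (X : Ω → ℕ+) (Y : Ω → 𝒴) : ℝ≥0∞ :=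
  ∫⁻ ω, shannon (condLaw μ X Y ω) ∂μ

/-- The two kinds of conditional Rényi entropy. -/
inductive Kind
  | arimoto
  | hayashi

/-- Arimoto's and Hayashi's conditional Rényi entropies of order `α`; both are the conditional
Shannon entropy if `α = 1`. -/
def condRenyi (kind : Kind) (α : ℝ) (μ : Measure Ω) [IsFiniteMeasure μ]
    (X : Ω → ℕ+) (Y : Ω → 𝒴) : EReal :=
  if α = 1 then ((condShannon μ X Y : ℝ≥0∞) : EReal)
  else match kind with
    | Kind.arimoto =>
        ((α / (1 - α) : ℝ) : EReal) * ENNReal.log (∫⁻ ω, alphaNorm α (condLaw μ X Y ω) ∂μ)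
    | Kind.hayashi =>
        ((1 / (1 - α) : ℝ) : EReal) * ENNReal.log (∫⁻ ω, alphaNorm α (condLaw μ X Y ω) ^ α ∂μ)

/-- A (measurable) list decoder with list size `L`: it maps each `y` to a nonempty set of at most
`L` letters. -/
def IsListDecoder (L : ℕ) (f : 𝒴 → Finset ℕ+) : Prop :=
  (∀ y, 1 ≤ (f y).card ∧ (f y).card ≤ L) ∧ ∀ x, MeasurableSet {y | x ∈ f y}

/-- The minimum average error probability under list decoding with list size `L`. -/
def listError (L : ℕ) (μ : Measure Ω) (X : Ω → ℕ+) (Y : Ω → 𝒴) : ℝ :=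
  sInf {p : ℝ | ∃ f : 𝒴 → Finset ℕ+, IsListDecoder L f ∧ p = μ.real {ω | X ω ∉ f (Y ω)}}

end Conditional

end FanoRenyi

end

/-! Sort the conditional law `P_{X|Y}` decreasingly for each outcome and average over `Y`, giving a
decreasing probability sequence `R(n) = 𝔼[P_{X|Y}↓(n)]`. Given `Y`, a list of `k` letters contains
`X` with probability at most the sum of the `k` largest conditional masses, so `P(X ∈ f(Y)) ≤ R(1) +
⋯ + R(k)` (`measure_mem_list_le`). Constant lists show that the partial sums of `R` dominate those
of `Q↓`; list decoders show that `R(1) + ⋯ + R(L) ≥ 1 - ε`. Among decreasing sequences with these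
two properties, the type-1 Fano distribution `P₁` has the smallest partial sums
(`isLeastMajorant_fanoType1`). It raises a block of `Q↓` ending at `L` to a constant, so that the
first `L` masses sum to `1 - ε`, and lowers the block after `L` to a constant to compensate. On a
flat block its partial sums are affine, while those of a decreasing sequence are concave, so a
comparison at the ends of the block gives one inside. The entropy bound then comes from a tangent
inequality at `P₁`: Hölder for `α > 1`, reverse Hölder for `α < 1`, Gibbs for `α = 1`. Each bounds
the functional of the sorted conditional law by a linear one, with equality at `P₁` and with weights
monotone in `n`. Expectation turns the sorted law into `R`, and summation by parts replaces `R` by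
`P₁`. Hayashi's entropy is at most Arimoto's by Jensen (`condRenyi_hayashi_le_arimoto`). -/

namespace FanoRenyi

/-! ### Decreasing rearrangement of a probability mass function -/

section Rearrangement

variable (Q : PMF ℕ+)

theorem finite_setOf_lt_mass {t : ℝ} (ht : 0 < t) : {x : ℕ+ | t < (Q x).toReal}.Finite := by
  have hs : Summable fun x => (Q x).toReal := ENNReal.summable_toReal (by simp [Q.tsum_coe])
  have h := hs.tendsto_cofinite_zero.eventually (gt_mem_nhds ht)
  rw [Filter.eventually_cofinite] at h
  exact h.subset fun x hx => not_lt.2 (le_of_lt hx)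

theorem mass_le_one (x : ℕ+) : (Q x).toReal ≤ 1 :=
  ENNReal.toReal_le_of_le_ofReal zero_le_one (by simpa using Q.coe_le_one x)

theorem one_mem_decr_set {n : ℕ} (hn : 1 ≤ n) :
    (1 : ℝ) ∈ {t : ℝ | 0 ≤ t ∧ {x : ℕ+ | t < (Q x).toReal}.encard < (n : ℕ∞)} := by
  refine ⟨zero_le_one, ?_⟩
  have : {x : ℕ+ | (1 : ℝ) < (Q x).toReal} = ∅ := by
    ext x
    simpa using mass_le_one Q x
  rw [this, Set.encard_empty]
  exact_mod_cast hn

theorem bddBelow_decr_set (n : ℕ) :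
    BddBelow {t : ℝ | 0 ≤ t ∧ {x : ℕ+ | t < (Q x).toReal}.encard < (n : ℕ∞)} :=
  ⟨0, fun _ h => h.1⟩

theorem decr_nonneg (n : ℕ) : 0 ≤ decr Q n := Real.sInf_nonneg fun _ h => h.1

theorem decr_le_decr {m n : ℕ} (hm : 1 ≤ m) (hmn : m ≤ n) : decr Q n ≤ decr Q m :=
  csInf_le_csInf (bddBelow_decr_set Q n) ⟨1, one_mem_decr_set Q hm⟩
    fun _ h => ⟨h.1, h.2.trans_le (by exact_mod_cast hmn)⟩

/-- For the converse, take the smallest of `n` masses exceeding `t`: any `u` below it is exceeded by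
all `n`, so it is a lower bound of the set defining `decr Q n`. -/
theorem lt_decr_iff {t : ℝ} (ht : 0 ≤ t) {n : ℕ} (hn : 1 ≤ n) :
    t < decr Q n ↔ (n : ℕ∞) ≤ {x : ℕ+ | t < (Q x).toReal}.encard := by
  constructor
  · intro h
    by_contra! hc
    exact absurd (csInf_le (bddBelow_decr_set Q n) ⟨ht, hc⟩) (not_le.2 h)
  · intro h
    obtain ⟨S, hS, hcard⟩ := Set.exists_subset_encard_eq h
    have hfin : S.Finite := Set.finite_of_encard_eq_coe hcard
    have hne : S.Nonempty := by
      rw [← Set.one_le_encard_iff_nonempty, hcard]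
      exact_mod_cast hn
    obtain ⟨x, hx, hmin⟩ := Set.exists_min_image S (fun x => (Q x).toReal) hfin hne
    refine lt_of_lt_of_le (hS hx) (le_csInf ⟨1, one_mem_decr_set Q hn⟩ ?_)
    rintro u ⟨-, hu⟩
    by_contra! hc
    have hsub : S ⊆ {x : ℕ+ | u < (Q x).toReal} := fun y hy => hc.trans_le (hmin y hy)
    exact absurd (hcard ▸ Set.encard_le_encard hsub) (not_le.2 hu)

/-- Only finitely many masses exceed `v / 2`, so there is a gap just below `v`. This turns the
strict counting criterion into the non-strict one. -/
theorem exists_lt_forall_le_mass {v : ℝ} (hv : 0 < v) :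
    ∃ t, 0 < t ∧ t < v ∧ ∀ x, t < (Q x).toReal → v ≤ (Q x).toReal := by
  have hfin : ({x : ℕ+ | v / 2 < (Q x).toReal ∧ (Q x).toReal < v}).Finite :=
    (finite_setOf_lt_mass Q (half_pos hv)).subset fun x hx => hx.1
  rcases Set.eq_empty_or_nonempty {x : ℕ+ | v / 2 < (Q x).toReal ∧ (Q x).toReal < v} with he | hne
  · refine ⟨v / 2, half_pos hv, half_lt_self hv, fun x hx => ?_⟩
    by_contra! hc
    have : x ∈ ({x : ℕ+ | v / 2 < (Q x).toReal ∧ (Q x).toReal < v}) := ⟨hx, hc⟩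
    simp [he] at this
  · obtain ⟨y, hy, hmax⟩ := Set.exists_max_image _ (fun x => (Q x).toReal) hfin hne
    refine ⟨(Q y).toReal, (half_pos hv).trans hy.1, hy.2, fun x hx => ?_⟩
    by_contra! hc
    exact absurd (hmax x ⟨hy.1.trans hx, hc⟩) (not_le.2 hx)

theorem le_decr_iff {v : ℝ} (hv : 0 < v) {n : ℕ} (hn : 1 ≤ n) :
    v ≤ decr Q n ↔ (n : ℕ∞) ≤ {x : ℕ+ | v ≤ (Q x).toReal}.encard := by
  obtain ⟨t, ht0, htv, ht⟩ := exists_lt_forall_le_mass Q hv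
  have key : ∀ u, t ≤ u → u < v →
      {x : ℕ+ | u < (Q x).toReal} = {x : ℕ+ | v ≤ (Q x).toReal} := fun u htu huv => by
    ext x
    exact ⟨fun h => ht x (htu.trans_lt h), fun h => huv.trans_le h⟩
  constructor
  · intro h
    rw [← key t le_rfl htv]
    exact (lt_decr_iff Q ht0.le hn).1 (htv.trans_le h)
  · intro h
    by_contra! hc
    have hu : max t (decr Q n) < v := max_lt htv hc
    have := (lt_decr_iff Q (ht0.le.trans (le_max_left t (decr Q n))) hn).2
      (by rwa [key _ (le_max_left _ _) hu])
    exact absurd this (not_lt.2 (le_max_right _ _))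

theorem encard_setOf_succ_le (N : ℕ∞) : {i : ℕ | ((i + 1 : ℕ) : ℕ∞) ≤ N}.encard = N := by
  induction N using ENat.recTopCoe with
  | top => simp [Set.encard_univ]
  | coe N =>
    have : {i : ℕ | ((i + 1 : ℕ) : ℕ∞) ≤ (N : ℕ∞)} = (Finset.range N : Set ℕ) := by
      ext i
      simp only [Set.mem_ofPred_eq, Nat.cast_le, Finset.coe_range, Set.mem_Iio]
      omega
    rw [this, Set.encard_coe_eq_coe_finsetCard, Finset.card_range]

/-- Both level sets are differences of superlevel sets, whose sizes agree by the two counting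
criteria; the strict one is finite for `v > 0`, so it can be cancelled. -/
theorem encard_level_decr {v : ℝ} (hv : 0 < v) :
    {i : ℕ | decr Q (i + 1) = v}.encard = {x : ℕ+ | (Q x).toReal = v}.encard := by
  have hfin := finite_setOf_lt_mass Q hv
  have h1 : {i : ℕ | v ≤ decr Q (i + 1)}.encard = {x : ℕ+ | v ≤ (Q x).toReal}.encard := by
    rw [← encard_setOf_succ_le {x : ℕ+ | v ≤ (Q x).toReal}.encard]
    congr 1
    ext i
    exact le_decr_iff Q hv (Nat.le_add_left 1 i)
  have h2 : {i : ℕ | v < decr Q (i + 1)}.encard = {x : ℕ+ | v < (Q x).toReal}.encard := by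
    rw [← encard_setOf_succ_le {x : ℕ+ | v < (Q x).toReal}.encard]
    congr 1
    ext i
    exact lt_decr_iff Q hv.le (Nat.le_add_left 1 i)
  have e1 : {i : ℕ | decr Q (i + 1) = v}
      = {i : ℕ | v ≤ decr Q (i + 1)} \ {i : ℕ | v < decr Q (i + 1)} := by
    ext i
    simp [le_antisymm_iff, and_comm]
  have e2 : {x : ℕ+ | (Q x).toReal = v}
      = {x : ℕ+ | v ≤ (Q x).toReal} \ {x : ℕ+ | v < (Q x).toReal} := by
    ext i
    simp [le_antisymm_iff, and_comm]
  have h3 := Set.encard_sdiff_add_encard_of_subset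
    (show {i : ℕ | v < decr Q (i + 1)} ⊆ {i : ℕ | v ≤ decr Q (i + 1)} from fun _ hi => (show v < _ from hi).le)
  have h4 := Set.encard_sdiff_add_encard_of_subset
    (show {x : ℕ+ | v < (Q x).toReal} ⊆ {x : ℕ+ | v ≤ (Q x).toReal} from fun _ hi => (show v < _ from hi).le)
  rw [← e1, h1, h2, ← h4, ← e2] at h3
  exact (ENat.add_left_injective_of_ne_top hfin.encard_lt_top.ne) h3

/-- The positive values of the decreasing rearrangement are the positive masses, with
multiplicity. -/
theorem exists_equiv_decr :
    ∃ e : {i : ℕ // 0 < decr Q (i + 1)} ≃ {x : ℕ+ // 0 < (Q x).toReal},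
      ∀ i, (Q (e i)).toReal = decr Q (i + 1) := by
  have h : ∀ v : ℝ, Nonempty ({a : {i : ℕ // 0 < decr Q (i + 1)} // decr Q (a + 1) = v} ≃
      {b : {x : ℕ+ // 0 < (Q x).toReal} // (Q b).toReal = v}) := by
    intro v
    rcases le_or_gt v 0 with hv | hv
    · have : IsEmpty {a : {i : ℕ // 0 < decr Q (i + 1)} // decr Q (a + 1) = v} :=
        ⟨fun a => absurd a.1.2 (by rw [a.2]; exact not_lt.2 hv)⟩
      have : IsEmpty {b : {x : ℕ+ // 0 < (Q x).toReal} // (Q b).toReal = v} :=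
        ⟨fun a => absurd a.1.2 (by rw [a.2]; exact not_lt.2 hv)⟩
      exact ⟨Equiv.equivOfIsEmpty _ _⟩
    · have hfin : {x : ℕ+ | (Q x).toReal = v}.Finite :=
        (finite_setOf_lt_mass Q (half_pos hv)).subset fun x hx => by
          have : (Q x).toReal = v := hx
          simp only [Set.mem_ofPred_eq, this]
          linarith
      have hc := encard_level_decr Q hv
      have hfin' : {i : ℕ | decr Q (i + 1) = v}.Finite := by
        rw [← Set.encard_lt_top_iff, hc]
        exact hfin.encard_lt_top
      have := hfin.to_subtype
      have := hfin'.to_subtype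
      have e : {i : ℕ | decr Q (i + 1) = v} ≃ {x : ℕ+ | (Q x).toReal = v} := by
        refine Nonempty.some (Finite.card_eq.1 ?_)
        rw [Nat.card_coe_set_eq, Nat.card_coe_set_eq, Set.ncard_def, Set.ncard_def, hc]
      have e1 : {a : {i : ℕ // 0 < decr Q (i + 1)} // decr Q (a + 1) = v} ≃
          {i : ℕ // decr Q (i + 1) = v} :=
        Equiv.subtypeSubtypeEquivSubtype (q := fun i : ℕ => decr Q (i + 1) = v)
          fun {i} hi => by rw [hi]; exact hv
      have e2 : {b : {x : ℕ+ // 0 < (Q x).toReal} // (Q b).toReal = v} ≃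
          {x : ℕ+ // (Q x).toReal = v} :=
        Equiv.subtypeSubtypeEquivSubtype (q := fun x : ℕ+ => (Q x).toReal = v)
          fun {i} hi => by rw [hi]; exact hv
      exact ⟨e1.trans (e.trans e2.symm)⟩
  -- The fibres over each value are equinumerous: empty for `v ≤ 0`, finite of equal size for `v >
  -- 0`. Gluing them gives the bijection.
  exact ⟨Equiv.ofFiberEquiv fun v => (h v).some, fun i =>
    Equiv.ofFiberEquiv_map (f := fun a : {i : ℕ // 0 < decr Q (i + 1)} => decr Q (a + 1))
      (g := fun b : {x : ℕ+ // 0 < (Q x).toReal} => (Q b).toReal) (fun v => (h v).some) i⟩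

/-- `F 0 = 0` is needed because `Q` and its rearrangement may have different numbers of zeros. -/
theorem tsum_mass_eq_tsum_decr (F : ℝ → ℝ≥0∞) (hF : F 0 = 0) :
    ∑' x, F (Q x).toReal = ∑' i : ℕ, F (decr Q (i + 1)) := by
  obtain ⟨e, he⟩ := exists_equiv_decr Q
  have h1 : ∑' x : {x : ℕ+ // 0 < (Q x).toReal}, F (Q x).toReal = ∑' x, F (Q x).toReal := by
    refine tsum_subtype_eq_of_support_subset (f := fun x => F (Q x).toReal)
      (s := {x : ℕ+ | 0 < (Q x).toReal}) fun x hx => ?_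
    by_contra hc
    have : (Q x).toReal = 0 := le_antisymm (not_lt.1 hc) ENNReal.toReal_nonneg
    simp [this, hF] at hx
  have h2 : ∑' i : {i : ℕ // 0 < decr Q (i + 1)}, F (decr Q (i + 1))
      = ∑' i : ℕ, F (decr Q (i + 1)) := by
    refine tsum_subtype_eq_of_support_subset (f := fun i : ℕ => F (decr Q (i + 1)))
      (s := {i : ℕ | 0 < decr Q (i + 1)}) fun x hx => ?_
    by_contra hc
    have : decr Q (x + 1) = 0 := le_antisymm (not_lt.1 hc) (decr_nonneg _ _)
    simp [this, hF] at hx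
  rw [← h1, ← h2, ← e.tsum_eq]
  simp only [he]

/-- Exchange argument: indices of `S` beyond `k` contribute at most `f k` each, and at least as many
indices below `k` are missing from `S`, each worth at least `f k`. -/
theorem sum_le_sum_range_of_antitone {f : ℕ → ℝ} (hf : Antitone f) (h0 : ∀ i, 0 ≤ f i)
    (S : Finset ℕ) {k : ℕ} (hS : S.card ≤ k) : ∑ i ∈ S, f i ≤ ∑ i ∈ Finset.range k, f i := by
  classical
  have hcard : (S \ Finset.range k).card ≤ (Finset.range k \ S).card := by
    have a1 := Finset.card_sdiff_add_card_inter S (Finset.range k)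
    have a2 := Finset.card_sdiff_add_card_inter (Finset.range k) S
    rw [Finset.inter_comm, Finset.card_range] at a2
    omega
  have h1 : ∑ i ∈ S \ Finset.range k, f i ≤ (S \ Finset.range k).card • f k :=
    Finset.sum_le_card_nsmul _ _ _ fun i hi => hf (by simp at hi; exact hi.2)
  have h2 : (Finset.range k \ S).card • f k ≤ ∑ i ∈ Finset.range k \ S, f i :=
    Finset.card_nsmul_le_sum _ _ _ fun i hi => hf (by simp at hi; exact hi.1.le)
  have h3 : (S \ Finset.range k).card • f k ≤ (Finset.range k \ S).card • f k :=
    nsmul_le_nsmul_left (h0 k) hcard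
  rw [← Finset.sum_inter_add_sum_sdiff S (Finset.range k),
    ← Finset.sum_inter_add_sum_sdiff (Finset.range k) S, Finset.inter_comm]
  linarith

theorem antitone_decr_succ : Antitone fun i : ℕ => decr Q (i + 1) :=
  fun _ _ h => decr_le_decr Q (by omega) (by omega)

theorem sum_mass_le_sum_decr (S : Finset ℕ+) {k : ℕ} (hS : S.card ≤ k) :
    ∑ x ∈ S, (Q x).toReal ≤ ∑ i ∈ Finset.range k, decr Q (i + 1) := by
  classical
  obtain ⟨e, he⟩ := exists_equiv_decr Q
  set T : Finset {x : ℕ+ // 0 < (Q x).toReal} := S.subtype _ with hT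
  have h1 : ∑ x ∈ S, (Q x).toReal = ∑ x ∈ T, (Q x).toReal := by
    rw [hT, Finset.sum_subtype_eq_sum_filter (f := fun x => (Q x).toReal), Finset.sum_filter]
    refine Finset.sum_congr rfl fun x _ => ?_
    split_ifs with h
    · rfl
    · exact le_antisymm (not_lt.1 h) ENNReal.toReal_nonneg
  set U : Finset ℕ := (T.map e.symm.toEmbedding).map (Function.Embedding.subtype _) with hU
  have h2 : ∑ x ∈ T, (Q x).toReal = ∑ i ∈ U, decr Q (i + 1) := by
    rw [hU, Finset.sum_map, Finset.sum_map]
    refine Finset.sum_congr rfl fun x _ => ?_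
    have := he (e.symm x)
    simpa using this
  have h3 : U.card ≤ k := by
    rw [hU, Finset.card_map, Finset.card_map, hT, Finset.card_subtype]
    exact (Finset.card_filter_le _ _).trans hS
  rw [h1, h2]
  exact sum_le_sum_range_of_antitone (antitone_decr_succ Q) (fun i => decr_nonneg Q _) U h3

/-- Only the positive terms are matched with letters, so the set is smaller than `k` when `Q` has
fewer than `k` atoms. -/
theorem exists_sum_mass_eq_sum_decr (k : ℕ) :
    ∃ S : Finset ℕ+, S.card ≤ k ∧
      ∑ x ∈ S, (Q x).toReal = ∑ i ∈ Finset.range k, decr Q (i + 1) := by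
  classical
  obtain ⟨e, he⟩ := exists_equiv_decr Q
  set T : Finset {i : ℕ // 0 < decr Q (i + 1)} := (Finset.range k).subtype _ with hT
  refine ⟨(T.map e.toEmbedding).map (Function.Embedding.subtype _), ?_, ?_⟩
  · rw [Finset.card_map, Finset.card_map, hT, Finset.card_subtype]
    exact (Finset.card_filter_le _ _).trans (by simp)
  · rw [Finset.sum_map, Finset.sum_map]
    calc ∑ x ∈ T, (Q (e x)).toReal = ∑ x ∈ T, decr Q (x + 1) :=
          Finset.sum_congr rfl fun x _ => he x
      _ = _ := by
        rw [hT, Finset.sum_subtype_eq_sum_filter (f := fun i : ℕ => decr Q (i + 1)),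
          Finset.sum_filter]
        refine Finset.sum_congr rfl fun x _ => ?_
        split_ifs with h
        · rfl
        · exact (le_antisymm (not_lt.1 h) (decr_nonneg _ _)).symm

theorem tsum_decr : ∑' i : ℕ, ENNReal.ofReal (decr Q (i + 1)) = 1 := by
  rw [← tsum_mass_eq_tsum_decr Q ENNReal.ofReal ENNReal.ofReal_zero, ← Q.tsum_coe]
  exact tsum_congr fun x => ENNReal.ofReal_toReal (Q.apply_ne_top x)

theorem hasSum_decr : HasSum (fun i : ℕ => decr Q (i + 1)) 1 := by
  have h := ENNReal.hasSum_toReal (f := fun i : ℕ => ENNReal.ofReal (decr Q (i + 1)))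
    (by simp [tsum_decr])
  rw [← ENNReal.tsum_toReal_eq fun _ => ENNReal.ofReal_ne_top, tsum_decr] at h
  simpa [ENNReal.toReal_ofReal (decr_nonneg Q _)] using h

theorem powerSum_mass {α : ℝ} (hα : 0 < α) :
    powerSum α (fun x => (Q x).toReal) = ∑' i : ℕ, ENNReal.ofReal (decr Q (i + 1)) ^ α :=
  tsum_mass_eq_tsum_decr Q (fun u => ENNReal.ofReal u ^ α) (by simp [hα])

theorem shannon_mass :
    shannon (fun x => (Q x).toReal)
      = ∑' i : ℕ, ENNReal.ofReal (Real.negMulLog (decr Q (i + 1))) :=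
  tsum_mass_eq_tsum_decr Q (fun u => ENNReal.ofReal (Real.negMulLog u)) (by simp)

end Rearrangement

/-! ### Majorization and tangent inequalities for the entropy functionals -/

section Majorization

/-- If the partial sums of `R` dominate those of `r` and both have total mass `1`, then `R` puts
less weight than `r` on every increasing function. -/
theorem tsum_mul_le_tsum_mul_of_monotone {R r g : ℕ → ℝ≥0∞} (hR : ∑' n, R n = 1)
    (hr : ∑' n, r n = 1)
    (hmaj : ∀ k, ∑ n ∈ Finset.range k, r n ≤ ∑ n ∈ Finset.range k, R n) (hg : Monotone g) :
    ∑' n, R n * g n ≤ ∑' n, r n * g n := by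
  -- Summation by parts: `g` is the sum of its nonnegative increments, so `∑ u g` is a nonnegative
  -- combination of the tails of `u`. This remains valid when `g` reaches `⊤`, as it does where `P₁`
  -- vanishes.
  obtain ⟨d, hd⟩ : ∃ d : ℕ → ℝ≥0∞, ∀ n, g n = ∑ k ∈ Finset.range (n + 1), d k := by
    refine ⟨fun k => Nat.casesOn k (g 0) fun j => g (j + 1) - g j, fun n => ?_⟩
    induction n with
    | zero => simp
    | succ n ih =>
      rw [Finset.sum_range_succ, ← ih]
      exact (add_tsub_cancel_of_le (hg (Nat.le_succ n))).symm
  have hsplit : ∀ u : ℕ → ℝ≥0∞,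
      ∑' n, u n * g n = ∑' k, d k * ∑' n, if k ≤ n then u n else 0 := by
    intro u
    simp_rw [← ENNReal.tsum_mul_left]
    rw [ENNReal.tsum_comm]
    refine tsum_congr fun n => ?_
    rw [hd n, Finset.mul_sum, tsum_eq_sum (s := Finset.range (n + 1))]
    · refine Finset.sum_congr rfl fun k hk => ?_
      rw [if_pos (by simpa [Nat.lt_succ_iff] using hk), mul_comm]
    · intro k hk
      rw [if_neg (by simpa [Nat.lt_succ_iff] using hk), mul_zero]
  have hht : ∀ (u : ℕ → ℝ≥0∞) (k : ℕ),
      (∑' n, if k ≤ n then u n else 0) + ∑ n ∈ Finset.range k, u n = ∑' n, u n := by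
    intro u k
    have : ∑ n ∈ Finset.range k, u n = ∑' n, if k ≤ n then 0 else u n := by
      rw [tsum_eq_sum (s := Finset.range k)]
      · refine Finset.sum_congr rfl fun n hn => ?_
        rw [if_neg (by simpa using hn)]
      · intro n hn
        rw [if_pos (by simpa using hn)]
    rw [this, ← ENNReal.tsum_add]
    refine tsum_congr fun n => ?_
    split_ifs <;> simp
  rw [hsplit, hsplit]
  refine ENNReal.tsum_le_tsum fun k => mul_le_mul_right ?_ _
  have hfin : ∑ n ∈ Finset.range k, r n ≠ ⊤ := by
    refine ne_top_of_le_ne_top ENNReal.one_ne_top ?_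
    rw [← hr]
    exact ENNReal.sum_le_tsum _
  refine (ENNReal.add_le_add_iff_right hfin).1 ?_
  rw [hht r k, hr, ← hR, ← hht R k]
  exact add_le_add_right (hmaj k) _

/-- Apply the increasing case to `g 0 - g`; finiteness of `g 0` permits the cancellation. -/
theorem tsum_mul_le_tsum_mul_of_antitone {R r g : ℕ → ℝ≥0∞} (hR : ∑' n, R n = 1)
    (hr : ∑' n, r n = 1)
    (hmaj : ∀ k, ∑ n ∈ Finset.range k, r n ≤ ∑ n ∈ Finset.range k, R n) (hg : Antitone g)
    (h0 : g 0 ≠ ⊤) :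
    ∑' n, r n * g n ≤ ∑' n, R n * g n := by
  have hsum : ∀ u : ℕ → ℝ≥0∞, ∑' n, u n = 1 →
      ∑' n, u n * (g 0 - g n) + ∑' n, u n * g n = g 0 := by
    intro u hu
    calc _ = ∑' n, u n * g 0 := by
          rw [← ENNReal.tsum_add]
          refine tsum_congr fun n => ?_
          rw [← mul_add, tsub_add_cancel_of_le (hg (Nat.zero_le n))]
      _ = g 0 := by rw [ENNReal.tsum_mul_right, hu, one_mul]
  have h := tsum_mul_le_tsum_mul_of_monotone (g := fun n => g 0 - g n) hR hr hmaj
    fun m n hmn => tsub_le_tsub_left (hg hmn) _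
  have hfin : ∑' n, r n * (g 0 - g n) ≠ ⊤ := by
    refine ne_top_of_le_ne_top h0 ?_
    conv_rhs => rw [← hsum r hr]
    exact le_self_add
  refine (ENNReal.add_le_add_iff_left hfin).1 ?_
  calc _ = ∑' n, R n * (g 0 - g n) + ∑' n, R n * g n := by rw [hsum r hr, hsum R hR]
    _ ≤ _ := add_le_add_left h _

theorem tsum_mul_le_Lp_mul_Lq {p q : ℝ} (hpq : p.HolderConjugate q) (f g : ℕ → ℝ≥0∞) :
    ∑' n, f n * g n ≤ (∑' n, f n ^ p) ^ (1 / p) * (∑' n, g n ^ q) ^ (1 / q) := by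
  have h := ENNReal.lintegral_mul_le_Lp_mul_Lq Measure.count hpq
    (measurable_of_countable f).aemeasurable (measurable_of_countable g).aemeasurable
  simpa only [lintegral_count, Pi.mul_apply] using h

/-- The tangent inequality for the `ℓ_α`-quasinorm, `α < 1` (reverse Hölder). -/
theorem norm_le_tsum_mul_of_lt_one {α : ℝ} (h0 : 0 < α) (h1 : α < 1) {p r : ℕ → ℝ≥0∞}
    (hr : ∀ n, r n ≠ ⊤) (hr0 : ∑' n, r n ^ α ≠ 0) :
    (∑' n, p n ^ α) ^ (1 / α)
      ≤ (∑' n, p n * r n ^ (α - 1)) * (∑' n, r n ^ α) ^ ((1 - α) / α) := by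
  have h1' : 0 < 1 - α := by linarith
  -- If `p` charges a zero of `r`, the weight `0 ^ (α - 1) = ⊤` makes the right-hand side infinite.
  -- Otherwise the powers of `r` below can be combined.
  by_cases hc : ∃ n, r n = 0 ∧ p n ≠ 0
  · obtain ⟨n, hn, hpn⟩ := hc
    have : ∑' n, p n * r n ^ (α - 1) = ⊤ := by
      refine ENNReal.tsum_eq_top_of_eq_top ⟨n, ?_⟩
      rw [hn, ENNReal.zero_rpow_of_neg (by linarith), ENNReal.mul_top hpn]
    rw [this, ENNReal.top_mul]
    · exact le_top
    · simp only [ne_eq, ENNReal.rpow_eq_zero_iff, hr0, false_and, false_or, not_and, not_lt]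
      intro _
      positivity
  · push Not at hc
    have hpq : (1 / α).HolderConjugate (1 / (1 - α)) := by
      rw [Real.holderConjugate_iff]
      refine ⟨(one_lt_div h0).2 h1, ?_⟩
      simp
    -- The factors are chosen so that their product is `p ^ α` and their powers of orders `1 / α`
    -- and `1 / (1 - α)` are `p * r ^ (α - 1)` and `r ^ α`.
    have h := tsum_mul_le_Lp_mul_Lq hpq (fun n => (p n * r n ^ (α - 1)) ^ α)
      (fun n => r n ^ (α * (1 - α)))
    have e1 : ∀ n, (p n * r n ^ (α - 1)) ^ α * r n ^ (α * (1 - α)) = p n ^ α := by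
      intro n
      by_cases hn : r n = 0
      · simp [hc n hn, h0]
      · rw [ENNReal.mul_rpow_of_nonneg _ _ h0.le, mul_assoc, ← ENNReal.rpow_mul,
          ← ENNReal.rpow_add _ _ hn (hr n)]
        have : (α - 1) * α + α * (1 - α) = 0 := by ring
        simp [this]
    have e2 : ∀ n, ((p n * r n ^ (α - 1)) ^ α) ^ (1 / α) = p n * r n ^ (α - 1) := by
      intro n
      rw [← ENNReal.rpow_mul, mul_one_div_cancel h0.ne', ENNReal.rpow_one]
    have e3 : ∀ n, (r n ^ (α * (1 - α))) ^ (1 / (1 - α)) = r n ^ α := by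
      intro n
      rw [← ENNReal.rpow_mul, mul_assoc, mul_one_div_cancel h1'.ne', mul_one]
    simp only [e1, e2, e3, one_div_one_div] at h
    calc (∑' n, p n ^ α) ^ (1 / α)
        ≤ ((∑' n, p n * r n ^ (α - 1)) ^ α * (∑' n, r n ^ α) ^ (1 - α)) ^ (1 / α) :=
          ENNReal.rpow_le_rpow h (by positivity)
      _ = _ := by
          rw [ENNReal.mul_rpow_of_nonneg _ _ (by positivity), ← ENNReal.rpow_mul,
            ← ENNReal.rpow_mul, mul_one_div_cancel h0.ne', ENNReal.rpow_one, mul_one_div]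

/-- The tangent inequality for the `ℓ_α`-norm, `α > 1` (Hölder). -/
theorem tsum_mul_le_norm_of_one_lt {α : ℝ} (h1 : 1 < α) (p r : ℕ → ℝ≥0∞) :
    ∑' n, p n * r n ^ (α - 1)
      ≤ (∑' n, p n ^ α) ^ (1 / α) * (∑' n, r n ^ α) ^ ((α - 1) / α) := by
  have h := tsum_mul_le_Lp_mul_Lq (Real.HolderConjugate.conjExponent h1) p
    (fun n => r n ^ (α - 1))
  have h1' : α - 1 ≠ 0 := by linarith
  have e : ∀ n, (r n ^ (α - 1)) ^ (α / (α - 1)) = r n ^ α := by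
    intro n
    rw [← ENNReal.rpow_mul, mul_div_cancel₀ _ h1']
  simpa only [Real.conjExponent, e, one_div_div] using h

/-- Gibbs' inequality, term by term. -/
theorem negMulLog_add_le {p r : ℝ≥0∞} (hp : p ≤ 1) (hr : r ≤ 1) :
    ENNReal.ofReal (Real.negMulLog p.toReal) + p
      ≤ p * (if r = 0 then ⊤ else ENNReal.ofReal (-Real.log r.toReal)) + r := by
  by_cases hp0 : p = 0
  · simp [hp0]
  by_cases hr0 : r = 0
  · simp [hr0, ENNReal.mul_top hp0]
  have hpt : p ≠ ⊤ := ne_top_of_le_ne_top ENNReal.one_ne_top hp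
  have hrt : r ≠ ⊤ := ne_top_of_le_ne_top ENNReal.one_ne_top hr
  obtain ⟨a, rfl⟩ : ∃ a : NNReal, p = a := ⟨p.toNNReal, (ENNReal.coe_toNNReal hpt).symm⟩
  obtain ⟨b, rfl⟩ : ∃ b : NNReal, r = b := ⟨r.toNNReal, (ENNReal.coe_toNNReal hrt).symm⟩
  rw [if_neg hr0]
  have ha : (0 : ℝ) < a := by
    have : a ≠ 0 := by simpa using hp0
    positivity
  have hb : (0 : ℝ) < b := by
    have : b ≠ 0 := by simpa using hr0
    positivity
  have ha1 : (a : ℝ) ≤ 1 := by exact_mod_cast hp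
  have hb1 : (b : ℝ) ≤ 1 := by exact_mod_cast hr
  have hlb : 0 ≤ -Real.log b := by
    have := Real.log_nonpos hb.le hb1
    linarith
  simp only [ENNReal.coe_toReal]
  rw [← ENNReal.ofReal_coe_nnreal (p := a), ← ENNReal.ofReal_coe_nnreal (p := b),
    ← ENNReal.ofReal_mul ha.le, ← ENNReal.ofReal_add (Real.negMulLog_nonneg ha.le ha1) ha.le,
    ← ENNReal.ofReal_add (by positivity) hb.le]
  refine ENNReal.ofReal_le_ofReal ?_
  have h := Real.log_le_sub_one_of_pos (div_pos hb ha)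
  rw [Real.log_div hb.ne' ha.ne'] at h
  have h2 := mul_le_mul_of_nonneg_left h ha.le
  have h3 : (a : ℝ) * (b / a - 1) = b - a := by field_simp
  rw [Real.negMulLog]
  linarith

/-- The correction terms `p` and `r` of the termwise inequality both sum to `1` and cancel; placing
one on each side avoids negative terms. -/
theorem tsum_negMulLog_le {p r : ℕ → ℝ≥0∞} (hp : ∑' n, p n = 1) (hr : ∑' n, r n = 1) :
    ∑' n, ENNReal.ofReal (Real.negMulLog (p n).toReal)
      ≤ ∑' n, p n * (if r n = 0 then ⊤ else ENNReal.ofReal (-Real.log (r n).toReal)) := by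
  have h := ENNReal.tsum_le_tsum fun n =>
    negMulLog_add_le (hp ▸ ENNReal.le_tsum n : p n ≤ 1) (hr ▸ ENNReal.le_tsum n : r n ≤ 1)
  rw [ENNReal.tsum_add, ENNReal.tsum_add, hp, hr] at h
  exact (ENNReal.add_le_add_iff_right ENNReal.one_ne_top).1 h

variable {Ω : Type*} [MeasurableSpace Ω] {μ : Measure Ω}
  {p : Ω → ℕ → ℝ≥0∞} {r : ℕ → ℝ≥0∞}

theorem tsum_lintegral_eq_one [IsProbabilityMeasure μ] (hpm : ∀ n, Measurable fun ω => p ω n) (hp : ∀ ω, ∑' n, p ω n = 1) :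
    ∑' n, ∫⁻ ω, p ω n ∂μ = 1 := by
  rw [← lintegral_tsum fun n => (hpm n).aemeasurable]
  simp [hp]

theorem lintegral_tsum_mul (hpm : ∀ n, Measurable fun ω => p ω n) (g : ℕ → ℝ≥0∞) :
    ∫⁻ ω, ∑' n, p ω n * g n ∂μ = ∑' n, (∫⁻ ω, p ω n ∂μ) * g n := by
  rw [lintegral_tsum fun n => ((hpm n).mul_const _).aemeasurable]
  exact tsum_congr fun n => lintegral_mul_const _ (hpm n)

/-- The tangent bound at `r` is linear in `p ω`, so integrating it leaves only the averaged
sequence. The weights `r ^ (α - 1)` increase because `r` decreases and `α < 1`, so majorization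
applies; at `r` itself the bound is an equality. -/
theorem lintegral_norm_le_of_lt_one [IsProbabilityMeasure μ] {α : ℝ} (h0 : 0 < α) (h1 : α < 1)
    (hpm : ∀ n, Measurable fun ω => p ω n) (hp : ∀ ω, ∑' n, p ω n = 1) (hr : ∑' n, r n = 1)
    (hanti : Antitone r)
    (hmaj : ∀ k, ∑ n ∈ Finset.range k, r n ≤ ∑ n ∈ Finset.range k, ∫⁻ ω, p ω n ∂μ) :
    ∫⁻ ω, (∑' n, p ω n ^ α) ^ (1 / α) ∂μ ≤ (∑' n, r n ^ α) ^ (1 / α) := by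
  have hrt : ∀ n, r n ≠ ⊤ := fun n =>
    ne_top_of_le_ne_top ENNReal.one_ne_top (hr ▸ ENNReal.le_tsum n)
  have hr0 : ∑' n, r n ^ α ≠ 0 := by
    intro h
    rw [ENNReal.tsum_eq_zero] at h
    have : ∀ n, r n = 0 := fun n => by simpa [h0, h0.le, h0.not_gt] using h n
    simp [this] at hr
  have e : ∀ n, r n * r n ^ (α - 1) = r n ^ α := by
    intro n
    by_cases hn : r n = 0
    · simp [hn, h0]
    · conv_lhs => rw [← ENNReal.rpow_one (r n), ← ENNReal.rpow_mul, one_mul,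
        ← ENNReal.rpow_add _ _ hn (hrt n)]
      congr 1
      ring
  calc ∫⁻ ω, (∑' n, p ω n ^ α) ^ (1 / α) ∂μ
      ≤ ∫⁻ ω, (∑' n, p ω n * r n ^ (α - 1)) * (∑' n, r n ^ α) ^ ((1 - α) / α) ∂μ :=
        lintegral_mono fun ω => norm_le_tsum_mul_of_lt_one h0 h1 hrt hr0
    _ = (∑' n, (∫⁻ ω, p ω n ∂μ) * r n ^ (α - 1)) * (∑' n, r n ^ α) ^ ((1 - α) / α) := by
        rw [lintegral_mul_const _ (Measurable.tsum fun n => (hpm n).mul_const _),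
          lintegral_tsum_mul hpm]
    _ ≤ (∑' n, r n * r n ^ (α - 1)) * (∑' n, r n ^ α) ^ ((1 - α) / α) := by
        refine mul_le_mul_left (tsum_mul_le_tsum_mul_of_monotone
          (tsum_lintegral_eq_one hpm hp) hr hmaj fun m n hmn => ?_) _
        have : α - 1 = -(1 - α) := by ring
        simp only [this, ENNReal.rpow_neg]
        exact ENNReal.inv_le_inv.2 (ENNReal.rpow_le_rpow (hanti hmn) (by linarith))
    _ = (∑' n, r n ^ α) ^ (1 / α) := by
        simp only [e]
        conv_lhs => rw [← ENNReal.rpow_one (∑' n, r n ^ α), ← ENNReal.rpow_mul, one_mul,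
          ← ENNReal.rpow_add_of_nonneg _ _ zero_le_one (div_nonneg (by linarith) h0.le)]
        congr 1
        field_simp
        ring

/-- As for `α < 1` with all inequalities reversed: the weights `r ^ (α - 1)` now decrease and are
bounded. The factor `(∑ r ^ α) ^ ((α - 1) / α)` is finite and nonzero, so it can be divided out. -/
theorem norm_le_lintegral_of_one_lt [IsProbabilityMeasure μ] {α : ℝ} (h1 : 1 < α)
    (hpm : ∀ n, Measurable fun ω => p ω n) (hp : ∀ ω, ∑' n, p ω n = 1) (hr : ∑' n, r n = 1)
    (hanti : Antitone r)
    (hmaj : ∀ k, ∑ n ∈ Finset.range k, r n ≤ ∑ n ∈ Finset.range k, ∫⁻ ω, p ω n ∂μ) :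
    (∑' n, r n ^ α) ^ (1 / α) ≤ ∫⁻ ω, (∑' n, p ω n ^ α) ^ (1 / α) ∂μ := by
  have h0 : 0 < α := by linarith
  have hr1 : ∀ n, r n ≤ 1 := fun n => hr ▸ ENNReal.le_tsum n
  have hr0 : ∑' n, r n ^ α ≠ 0 := by
    intro h
    rw [ENNReal.tsum_eq_zero] at h
    have : ∀ n, r n = 0 := fun n => by simpa [h0, h0.le, h0.not_gt] using h n
    simp [this] at hr
  have hrt : ∑' n, r n ^ α ≠ ⊤ := by
    refine ne_top_of_le_ne_top ENNReal.one_ne_top ?_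
    rw [← hr]
    exact ENNReal.tsum_le_tsum fun n => ENNReal.rpow_le_self_of_le_one (hr1 n) h1.le
  have e : ∀ n, r n * r n ^ (α - 1) = r n ^ α := by
    intro n
    conv_lhs => rw [← ENNReal.rpow_one (r n), ← ENNReal.rpow_mul, one_mul,
      ← ENNReal.rpow_add_of_nonneg _ _ zero_le_one (by linarith)]
    congr 1
    ring
  have key : ∑' n, r n ^ α
      ≤ (∫⁻ ω, (∑' n, p ω n ^ α) ^ (1 / α) ∂μ) * (∑' n, r n ^ α) ^ ((α - 1) / α) :=
    calc ∑' n, r n ^ α = ∑' n, r n * r n ^ (α - 1) := by simp only [e]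
      _ ≤ ∑' n, (∫⁻ ω, p ω n ∂μ) * r n ^ (α - 1) := by
          refine tsum_mul_le_tsum_mul_of_antitone (tsum_lintegral_eq_one hpm hp) hr hmaj
            (fun m n hmn => ENNReal.rpow_le_rpow (hanti hmn) (by linarith)) ?_
          exact ENNReal.rpow_ne_top_of_nonneg (by linarith)
            (ne_top_of_le_ne_top ENNReal.one_ne_top (hr1 0))
      _ = ∫⁻ ω, ∑' n, p ω n * r n ^ (α - 1) ∂μ := (lintegral_tsum_mul hpm _).symm
      _ ≤ ∫⁻ ω, (∑' n, p ω n ^ α) ^ (1 / α) * (∑' n, r n ^ α) ^ ((α - 1) / α) ∂μ :=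
          lintegral_mono fun ω => tsum_mul_le_norm_of_one_lt h1 _ _
      _ = _ := lintegral_mul_const _
          ((Measurable.tsum fun n => (hpm n).pow_const _).pow_const _)
  have e2 : ∑' n, r n ^ α = (∑' n, r n ^ α) ^ (1 / α) * (∑' n, r n ^ α) ^ ((α - 1) / α) := by
    rw [← ENNReal.rpow_add _ _ hr0 hrt]
    have : 1 / α + (α - 1) / α = 1 := by field_simp; ring
    rw [this, ENNReal.rpow_one]
  rw [e2] at key
  have hx0 : (∑' n, r n ^ α) ^ ((α - 1) / α) ≠ 0 := by simp [hr0, hrt]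
  have hxt : (∑' n, r n ^ α) ^ ((α - 1) / α) ≠ ⊤ :=
    ENNReal.rpow_ne_top_of_nonneg (div_nonneg (by linarith) h0.le) hrt
  rw [← e2] at key
  conv_lhs at key => rw [e2]
  exact (ENNReal.mul_le_mul_iff_left hx0 hxt).1 key

/-- The same scheme with the increasing weights `-log r`, set to `⊤` at the zeros of `r`. -/
theorem lintegral_negMulLog_le [IsProbabilityMeasure μ]
    (hpm : ∀ n, Measurable fun ω => p ω n) (hp : ∀ ω, ∑' n, p ω n = 1) (hr : ∑' n, r n = 1)
    (hanti : Antitone r)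
    (hmaj : ∀ k, ∑ n ∈ Finset.range k, r n ≤ ∑ n ∈ Finset.range k, ∫⁻ ω, p ω n ∂μ) :
    ∫⁻ ω, ∑' n, ENNReal.ofReal (Real.negMulLog (p ω n).toReal) ∂μ
      ≤ ∑' n, ENNReal.ofReal (Real.negMulLog (r n).toReal) := by
  have hrt : ∀ n, r n ≠ ⊤ := fun n =>
    ne_top_of_le_ne_top ENNReal.one_ne_top (hr ▸ ENNReal.le_tsum n)
  set g : ℕ → ℝ≥0∞ := fun n =>
    if r n = 0 then ⊤ else ENNReal.ofReal (-Real.log (r n).toReal) with hg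
  have hgm : Monotone g := by
    intro m n hmn
    simp only [hg]
    by_cases hn : r n = 0
    · simp [hn]
    have hm : r m ≠ 0 := fun h => hn (le_antisymm (h ▸ hanti hmn) zero_le)
    rw [if_neg hn, if_neg hm]
    refine ENNReal.ofReal_le_ofReal (neg_le_neg (Real.log_le_log ?_ ?_))
    · exact ENNReal.toReal_pos hn (hrt n)
    · exact ENNReal.toReal_mono (hrt m) (hanti hmn)
  calc ∫⁻ ω, ∑' n, ENNReal.ofReal (Real.negMulLog (p ω n).toReal) ∂μ
      ≤ ∫⁻ ω, ∑' n, p ω n * g n ∂μ := lintegral_mono fun ω => tsum_negMulLog_le (hp ω) hr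
    _ = ∑' n, (∫⁻ ω, p ω n ∂μ) * g n := lintegral_tsum_mul hpm g
    _ ≤ ∑' n, r n * g n :=
        tsum_mul_le_tsum_mul_of_monotone (tsum_lintegral_eq_one hpm hp) hr hmaj hgm
    _ = _ := tsum_congr fun n => by
        simp only [hg]
        by_cases hn : r n = 0
        · simp [hn]
        · rw [if_neg hn]
          conv_lhs => rw [← ENNReal.ofReal_toReal (hrt n)]
          rw [← ENNReal.ofReal_mul ENNReal.toReal_nonneg, Real.negMulLog]
          congr 1
          rw [ENNReal.ofReal_toReal (hrt n)]
          ring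

end Majorization

/-! ### Flattening a decreasing sequence: the least majorant -/

section Flattening

theorem sum_range_of_const {p : ℕ → ℝ} {a b : ℕ} {v : ℝ} (hp : ∀ i, a ≤ i → i < b → p i = v)
    {m : ℕ} (ham : a ≤ m) (hmb : m ≤ b) :
    ∑ i ∈ Finset.range m, p i = ∑ i ∈ Finset.range a, p i + ((m : ℝ) - a) * v := by
  induction m, ham using Nat.le_induction with
  | base => simp
  | succ m ham ih =>
    rw [Finset.sum_range_succ, ih (by omega), hp m ham (by omega)]
    push_cast
    ring

/-- Partial sums of `p` are affine on `[a, b]`, those of `f` concave. Concretely, if `v ≤ f m` then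
`f ≥ v` on `[a, m)` and the comparison propagates forward from `a`; otherwise `f ≤ v` on `[m, b)`
and it propagates back from `b`. -/
theorem sum_range_le_of_const {p f : ℕ → ℝ} {a b : ℕ} {v : ℝ}
    (hp : ∀ i, a ≤ i → i < b → p i = v) (hf : Antitone f)
    (ha : ∑ i ∈ Finset.range a, p i ≤ ∑ i ∈ Finset.range a, f i)
    (hb : ∑ i ∈ Finset.range b, p i ≤ ∑ i ∈ Finset.range b, f i)
    {m : ℕ} (ham : a ≤ m) (hmb : m ≤ b) :
    ∑ i ∈ Finset.range m, p i ≤ ∑ i ∈ Finset.range m, f i := by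
  rcases le_total v (f m) with h | h
  · have h1 : ((m : ℝ) - a) * f m ≤ ∑ i ∈ Finset.Ico a m, f i := by
      have := Finset.card_nsmul_le_sum (Finset.Ico a m) f (f m)
        fun i hi => hf (Finset.mem_Ico.1 hi).2.le
      simpa [Nat.cast_sub ham] using this
    rw [sum_range_of_const hp ham hmb, ← Finset.sum_range_add_sum_Ico f ham]
    have : ((m : ℝ) - a) * v ≤ ((m : ℝ) - a) * f m :=
      mul_le_mul_of_nonneg_left h (sub_nonneg.2 (by exact_mod_cast ham))
    linarith
  · have h1 : ∑ i ∈ Finset.Ico m b, f i ≤ ((b : ℝ) - m) * f m := by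
      have := Finset.sum_le_card_nsmul (Finset.Ico m b) f (f m)
        fun i hi => hf (Finset.mem_Ico.1 hi).1
      simpa [Nat.cast_sub hmb] using this
    have h2 : ((b : ℝ) - m) * f m ≤ ((b : ℝ) - m) * v :=
      mul_le_mul_of_nonneg_left h (sub_nonneg.2 (by exact_mod_cast hmb))
    have h3 := sum_range_of_const (fun i hi => hp i (ham.trans hi)) hmb le_rfl
    rw [← Finset.sum_range_add_sum_Ico f hmb] at hb
    linarith

/-- `p` is a decreasing probability sequence, putting mass `c` on its first `L` terms, and
majorized by every decreasing sequence that majorizes `q` and puts mass at least `c` on its first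
`L` terms. -/
structure IsLeastMajorant (q p : ℕ → ℝ) (c : ℝ) (L : ℕ) : Prop where
  antitone : Antitone p
  nonneg : ∀ i, 0 ≤ p i
  hasSum : HasSum p 1
  sum_range : ∑ i ∈ Finset.range L, p i = c
  sum_range_le : ∀ f : ℕ → ℝ, Antitone f → (∀ i, 0 ≤ f i) →
    (∀ k, ∑ i ∈ Finset.range k, q i ≤ ∑ i ∈ Finset.range k, f i) →
    c ≤ ∑ i ∈ Finset.range L, f i →
    ∀ k, ∑ i ∈ Finset.range k, p i ≤ ∑ i ∈ Finset.range k, f i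

variable {q p : ℕ → ℝ} {c : ℝ} {L : ℕ}

theorem isLeastMajorant_self (hq : Antitone q) (hq0 : ∀ i, 0 ≤ q i) (hq1 : HasSum q 1)
    (hc : ∑ i ∈ Finset.range L, q i = c) : IsLeastMajorant q q c L :=
  ⟨hq, hq0, hq1, hc, fun _ _ _ h _ => h⟩

/-- Up to `j` and from `k` on, the partial sums of `p` are those of `q`, and at `L` the sum is `c`;
each is a lower bound required of `f`. On the flat blocks `[j, L)` and `[L, k)` the affine-concave
comparison fills in the rest. -/
theorem isLeastMajorant_of_finite (hq : Antitone q) (hq0 : ∀ i, 0 ≤ q i) (hq1 : HasSum q 1)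
    {j k : ℕ} {v w : ℝ} (hjL : j < L) (hLk : L < k)
    (hp1 : ∀ i, i < j → p i = q i) (hp2 : ∀ i, j ≤ i → i < L → p i = v)
    (hp3 : ∀ i, L ≤ i → i < k → p i = w) (hp4 : ∀ i, k ≤ i → p i = q i)
    (hv1 : ∀ i, i < j → v ≤ q i) (hv2 : q j ≤ v) (hw1 : w ≤ q (k - 1)) (hw2 : q k ≤ w)
    (hv : ∑ i ∈ Finset.range j, q i + ((L : ℝ) - j) * v = c)
    (hw : c + ((k : ℝ) - L) * w = ∑ i ∈ Finset.range k, q i) :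
    IsLeastMajorant q p c L := by
  have hsj : ∀ m, m ≤ j → ∑ i ∈ Finset.range m, p i = ∑ i ∈ Finset.range m, q i := fun m hm =>
    Finset.sum_congr rfl fun i hi => hp1 i ((Finset.mem_range.1 hi).trans_le hm)
  have hsL : ∑ i ∈ Finset.range L, p i = c := by
    rw [sum_range_of_const hp2 hjL.le le_rfl, hsj j le_rfl, hv]
  have hsk : ∀ m, k ≤ m → ∑ i ∈ Finset.range m, p i = ∑ i ∈ Finset.range m, q i := by
    intro m hm
    rw [← Finset.sum_range_add_sum_Ico p hm, ← Finset.sum_range_add_sum_Ico q hm,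
      sum_range_of_const hp3 hLk.le le_rfl, hsL, hw]
    congr 1
    exact Finset.sum_congr rfl fun i hi => hp4 i (Finset.mem_Ico.1 hi).1
  have hw0 : 0 ≤ w := (hq0 k).trans hw2
  have hv0 : 0 ≤ v := (hq0 j).trans hv2
  have hwq : ∀ i, i < k → w ≤ q i := fun i hi => hw1.trans (hq (by omega))
  have hwv : w ≤ v := (hwq j (by omega)).trans hv2
  have hnn : ∀ i, 0 ≤ p i := by
    intro i
    rcases lt_or_ge i j with h1 | h1
    · rw [hp1 i h1]; exact hq0 i
    rcases lt_or_ge i L with h2 | h2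
    · rw [hp2 i h1 h2]; exact hv0
    rcases lt_or_ge i k with h3 | h3
    · rw [hp3 i h2 h3]; exact hw0
    · rw [hp4 i h3]; exact hq0 i
  refine ⟨antitone_nat_of_succ_le fun i => ?_, hnn, ?_, hsL, ?_⟩
  · rcases lt_or_ge (i + 1) j with h1 | h1
    · rw [hp1 _ h1, hp1 i (by omega)]; exact hq (Nat.le_succ i)
    rcases lt_or_ge (i + 1) L with h2 | h2
    · rw [hp2 _ h1 h2]
      rcases lt_or_ge i j with h | h
      · rw [hp1 i h]; exact hv1 i h
      · rw [hp2 i h (by omega)]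
    rcases lt_or_ge (i + 1) k with h3 | h3
    · rw [hp3 _ h2 h3]
      rcases lt_or_ge i L with h | h
      · rw [hp2 i (by omega) h]; exact hwv
      · rw [hp3 i h (by omega)]
    · rw [hp4 _ h3]
      rcases lt_or_ge i k with h | h
      · rw [hp3 i (by omega) h]; exact (hq h3).trans hw2
      · rw [hp4 i h]; exact hq (Nat.le_succ i)
  · rw [hasSum_iff_tendsto_nat_of_nonneg hnn]
    refine hq1.tendsto_sum_nat.congr' ?_
    filter_upwards [Filter.eventually_ge_atTop k] with m hm
    exact (hsk m hm).symm
  · intro f hf hf0 hqf hcf m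
    rcases le_total m j with h1 | h1
    · rw [hsj m h1]; exact hqf m
    rcases le_total m L with h2 | h2
    · refine sum_range_le_of_const hp2 hf ?_ ?_ h1 h2
      · rw [hsj j le_rfl]; exact hqf j
      · rwa [hsL]
    rcases le_total m k with h3 | h3
    · refine sum_range_le_of_const hp3 hf ?_ ?_ h2 h3
      · rwa [hsL]
      · rw [hsk k le_rfl]; exact hqf k
    · rw [hsk m h3]; exact hqf m

/-- Here the first `L` terms carry all the mass, so from `L` on the partial sums stay at `c`. -/
theorem isLeastMajorant_of_infinite (hq : Antitone q) (hq0 : ∀ i, 0 ≤ q i)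
    {j : ℕ} {v : ℝ} (hjL : j < L)
    (hp1 : ∀ i, i < j → p i = q i) (hp2 : ∀ i, j ≤ i → i < L → p i = v)
    (hp3 : ∀ i, L ≤ i → p i = 0)
    (hv1 : ∀ i, i < j → v ≤ q i) (hv2 : q j ≤ v)
    (hv : ∑ i ∈ Finset.range j, q i + ((L : ℝ) - j) * v = c) (hc : c = 1) :
    IsLeastMajorant q p c L := by
  have hsj : ∀ m, m ≤ j → ∑ i ∈ Finset.range m, p i = ∑ i ∈ Finset.range m, q i := fun m hm =>
    Finset.sum_congr rfl fun i hi => hp1 i ((Finset.mem_range.1 hi).trans_le hm)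
  have hsL : ∑ i ∈ Finset.range L, p i = c := by
    rw [sum_range_of_const hp2 hjL.le le_rfl, hsj j le_rfl, hv]
  have hsk : ∀ m, L ≤ m → ∑ i ∈ Finset.range m, p i = c := by
    intro m hm
    rw [sum_range_of_const (fun i hi _ => hp3 i hi) hm le_rfl, hsL, mul_zero, add_zero]
  have hv0 : 0 ≤ v := (hq0 j).trans hv2
  have hnn : ∀ i, 0 ≤ p i := by
    intro i
    rcases lt_or_ge i j with h1 | h1
    · rw [hp1 i h1]; exact hq0 i
    rcases lt_or_ge i L with h2 | h2
    · rw [hp2 i h1 h2]; exact hv0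
    · rw [hp3 i h2]
  refine ⟨antitone_nat_of_succ_le fun i => ?_, hnn, ?_, hsL, ?_⟩
  · rcases lt_or_ge (i + 1) j with h1 | h1
    · rw [hp1 _ h1, hp1 i (by omega)]; exact hq (Nat.le_succ i)
    rcases lt_or_ge (i + 1) L with h2 | h2
    · rw [hp2 _ h1 h2]
      rcases lt_or_ge i j with h | h
      · rw [hp1 i h]; exact hv1 i h
      · rw [hp2 i h (by omega)]
    · rw [hp3 _ h2]; exact hnn i
  · rw [hasSum_iff_tendsto_nat_of_nonneg hnn]
    refine tendsto_const_nhds.congr' ?_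
    filter_upwards [Filter.eventually_ge_atTop L] with m hm
    rw [hsk m hm, hc]
  · intro f hf hf0 hqf hcf m
    rcases le_total m j with h1 | h1
    · rw [hsj m h1]; exact hqf m
    rcases le_total m L with h2 | h2
    · refine sum_range_le_of_const hp2 hf ?_ ?_ h1 h2
      · rw [hsj j le_rfl]; exact hqf j
      · rwa [hsL]
    · rw [hsk m h2]
      exact hcf.trans (Finset.sum_le_sum_of_subset_of_nonneg (Finset.range_mono h2)
        fun i _ _ => hf0 i)

end Flattening

/-! ### The type-1 Fano distribution as least majorant, and sums over it -/

section FanoDistribution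

variable (Q : PMF ℕ+) {L : ℕ} {ε : ℝ}

theorem sum_Icc_decr (k : ℕ) :
    ∑ x ∈ Finset.Icc 1 k, decr Q x = ∑ i ∈ Finset.range k, decr Q (i + 1) := by
  rw [Finset.range_eq_Ico, Finset.sum_Ico_add' (decr Q) 0 k 1]
  rfl

theorem sum_Ico_decr (j : ℕ) :
    ∑ x ∈ Finset.Ico 1 (j + 1), decr Q x = ∑ i ∈ Finset.range j, decr Q (i + 1) := by
  rw [Finset.range_eq_Ico, Finset.sum_Ico_add' (decr Q) 0 j 1, zero_add]

theorem sum_range_decr_le_one (k : ℕ) : ∑ i ∈ Finset.range k, decr Q (i + 1) ≤ 1 :=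
  sum_le_hasSum _ (fun _ _ => decr_nonneg Q _) (hasSum_decr Q)

theorem weightV_of_lt {j : ℕ} (hj : j < L) :
    weightV Q L ε (j + 1)
      = ((1 - ε) - ∑ i ∈ Finset.range j, decr Q (i + 1)) / ((L : ℝ) - j) := by
  rw [weightV, if_pos (by omega), sum_Ico_decr]
  congr 1
  push_cast
  ring

theorem weightV_of_gt {j : ℕ} (hj : L < j) : weightV Q L ε j = 1 := by
  rw [weightV, if_neg (by omega)]

theorem decr_lt_weightV_iff {j : ℕ} (hj : j < L) :
    decr Q (j + 1) < weightV Q L ε (j + 1) ↔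
      ∑ i ∈ Finset.range j, decr Q (i + 1) + ((L : ℝ) - j) * decr Q (j + 1) < 1 - ε := by
  have : (0 : ℝ) < (L : ℝ) - j := sub_pos.2 (by exact_mod_cast hj)
  rw [weightV_of_lt Q hj, lt_div_iff₀ this, lt_sub_iff_add_lt', mul_comm]

theorem weightW_of_lt {k : ℕ} (hk : L < k) :
    weightW Q L ε (k : ℕ∞)
      = (∑ i ∈ Finset.range k, decr Q (i + 1) - (1 - ε)) / ((k : ℝ) - L) := by
  have h : ((k : ℕ) : ℕ∞) ≠ (L : ℕ∞) := by exact_mod_cast hk.ne'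
  rw [weightW, if_neg (by simp), if_neg h, ENat.toNat_natCast, sum_Icc_decr]

theorem weightW_lt_decr_iff {k : ℕ} (hk : L < k) :
    weightW Q L ε (k : ℕ∞) < decr Q k ↔
      ∑ i ∈ Finset.range k, decr Q (i + 1) - ((k : ℝ) - L) * decr Q k < 1 - ε := by
  have : (0 : ℝ) < (k : ℝ) - L := sub_pos.2 (by exact_mod_cast hk)
  rw [weightW_of_lt Q hk, div_lt_iff₀ this, sub_lt_comm, mul_comm]

/-- Two masses equal to `1` would exceed the total. Hence `L + 1` lies in the set defining `J`, and
the infimum there is a true minimum. -/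
theorem decr_lt_one {n : ℕ} (hn : 2 ≤ n) : decr Q n < 1 := by
  by_contra! h
  have h1 : 1 ≤ decr Q 1 := h.trans (decr_le_decr Q le_rfl (by omega))
  have h2 : 1 ≤ decr Q 2 := h.trans (decr_le_decr Q (by omega) hn)
  have := sum_range_decr_le_one Q 2
  simp only [Finset.sum_range_succ, Finset.sum_range_zero, zero_add] at this
  norm_num at this
  linarith

theorem succ_mem_indexJ_set (hL : 1 ≤ L) :
    L + 1 ∈ {j : ℕ | 1 ≤ j ∧ decr Q j < weightV Q L ε j} := by
  refine ⟨by omega, ?_⟩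
  rw [weightV_of_gt Q (by omega)]
  exact decr_lt_one Q (by omega)

theorem indexJ_mem (hL : 1 ≤ L) :
    1 ≤ indexJ Q L ε ∧ decr Q (indexJ Q L ε) < weightV Q L ε (indexJ Q L ε) :=
  Nat.sInf_mem ⟨_, succ_mem_indexJ_set Q hL⟩

theorem indexJ_le (hL : 1 ≤ L) : indexJ Q L ε ≤ L + 1 :=
  Nat.sInf_le (succ_mem_indexJ_set Q hL)

theorem weightV_le_decr_of_lt {j : ℕ} (h1 : 1 ≤ j) (hj : j < indexJ Q L ε) :
    weightV Q L ε j ≤ decr Q j := by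
  by_contra! h
  exact Nat.notMem_of_lt_sInf hj ⟨h1, h⟩

theorem le_indexK_of_mem {k : ℕ} (hk : L ≤ k) (h : weightW Q L ε (k : ℕ∞) < decr Q k) :
    (k : ℕ∞) ≤ indexK Q L ε := le_sSup ⟨k, rfl, hk, h⟩

theorem weightW_self_lt : weightW Q L ε (L : ℕ∞) < decr Q L := by
  rw [weightW, if_neg (by simp), if_pos rfl]
  have := decr_nonneg Q L
  linarith

theorem le_indexK : (L : ℕ∞) ≤ indexK Q L ε := le_indexK_of_mem Q le_rfl (weightW_self_lt Q)

/-- When `Q↓` itself meets the constraint with equality, monotonicity rules out `J ≤ L` and `K > L`,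
so nothing is flattened. -/
theorem fanoType1_eq_decr_of_sum_eq (hL : 1 ≤ L)
    (hc : ∑ i ∈ Finset.range L, decr Q (i + 1) = 1 - ε) (x : ℕ+) :
    fanoType1 Q L ε x = decr Q x := by
  have hJ : L < indexJ Q L ε := by
    obtain ⟨h1, h2⟩ := indexJ_mem Q (ε := ε) hL
    obtain ⟨j, hj⟩ : ∃ j, indexJ Q L ε = j + 1 := ⟨indexJ Q L ε - 1, by omega⟩
    rw [hj] at h2
    by_contra! hJL
    have hjL : j < L := by omega
    rw [decr_lt_weightV_iff Q hjL, ← hc, ← Finset.sum_range_add_sum_Ico _ hjL.le] at h2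
    have := Finset.sum_le_card_nsmul (Finset.Ico j L) (fun i => decr Q (i + 1)) (decr Q (j + 1))
      fun i hi => decr_le_decr Q (by omega) (by have := (Finset.mem_Ico.1 hi).1; omega)
    rw [Nat.card_Ico, nsmul_eq_mul, Nat.cast_sub hjL.le] at this
    linarith
  have hK : indexK Q L ε ≤ L := by
    refine sSup_le ?_
    rintro m ⟨k, rfl, hk, h⟩
    by_contra! hkL
    have hkL' : L < k := by exact_mod_cast hkL
    rw [weightW_lt_decr_iff Q hkL', ← hc, ← Finset.sum_range_add_sum_Ico _ hkL'.le] at h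
    have := Finset.card_nsmul_le_sum (Finset.Ico L k) (fun i => decr Q (i + 1)) (decr Q k)
      fun i hi => decr_le_decr Q (by omega) (by have := (Finset.mem_Ico.1 hi).2; omega)
    rw [Nat.card_Ico, nsmul_eq_mul, Nat.cast_sub hkL'.le] at this
    linarith
  rw [fanoType1, if_pos]
  rcases le_or_gt (x : ℕ) L with h | h
  · exact Or.inl (h.trans_lt hJ)
  · exact Or.inr (hK.trans_lt (by exact_mod_cast h))

theorem isLeastMajorant_fanoType1 (hL : 1 ≤ L)
    (hc : ∑ i ∈ Finset.range L, decr Q (i + 1) ≤ 1 - ε) (hc1 : 0 ≤ ε) :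
    IsLeastMajorant (fun i => decr Q (i + 1)) (fun i => fanoType1 Q L ε i.succPNat)
      (1 - ε) L := by
  have hq := antitone_decr_succ Q
  have hq0 : ∀ i : ℕ, 0 ≤ decr Q (i + 1) := fun i => decr_nonneg Q _
  have hq1 := hasSum_decr Q
  rcases hc.eq_or_lt with hc | hc
  · have : (fun i : ℕ => fanoType1 Q L ε i.succPNat) = fun i => decr Q (i + 1) := by
      funext i
      rw [fanoType1_eq_decr_of_sum_eq Q hL hc]
      rfl
    rw [this]
    exact isLeastMajorant_self hq hq0 hq1 hc
  obtain ⟨h1, h2⟩ := indexJ_mem Q (ε := ε) hL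
  have hJL : indexJ Q L ε ≤ L := by
    refine Nat.sInf_le ⟨hL, ?_⟩
    obtain ⟨l, rfl⟩ : ∃ l, L = l + 1 := ⟨L - 1, by omega⟩
    rw [decr_lt_weightV_iff Q (Nat.lt_succ_self l)]
    rw [Finset.sum_range_succ] at hc
    push_cast
    linarith
  obtain ⟨j, hj⟩ : ∃ j, indexJ Q L ε = j + 1 := ⟨indexJ Q L ε - 1, by omega⟩
  have hjL : j < L := by omega
  have hjL' : (0 : ℝ) < (L : ℝ) - j := sub_pos.2 (by exact_mod_cast hjL)
  -- For `k = L + 1` the criterion reads `∑_{x ≤ L} Q↓(x) < 1 - ε`, the strict inequality at hand.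
  have hKL : ((L + 1 : ℕ) : ℕ∞) ≤ indexK Q L ε := by
    refine le_indexK_of_mem Q (by omega) ?_
    rw [weightW_lt_decr_iff Q (by omega), Finset.sum_range_succ]
    push_cast
    linarith
  have hp1 : ∀ i, i < j → fanoType1 Q L ε i.succPNat = decr Q (i + 1) := by
    intro i hi
    rw [fanoType1, if_pos]
    · rfl
    · left
      rw [Nat.succPNat_coe, hj]
      omega
  have hp2 : ∀ i, j ≤ i → i < L → fanoType1 Q L ε i.succPNat = weightV Q L ε (j + 1) := by
    intro i hi hiL
    rw [fanoType1, if_neg, if_pos, hj]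
    · rw [Nat.succPNat_coe]; omega
    · rw [Nat.succPNat_coe, hj, not_or, not_lt, not_lt]
      refine ⟨by omega, le_trans ?_ hKL⟩
      exact_mod_cast (by omega : i.succ ≤ L + 1)
  have hv : ∑ i ∈ Finset.range j, decr Q (i + 1) + ((L : ℝ) - j) * weightV Q L ε (j + 1)
      = 1 - ε := by
    rw [weightV_of_lt Q hjL, mul_div_cancel₀ _ hjL'.ne']
    ring
  -- Minimality of `J`: failure of the criterion at `J - 1` says that the average needed from `J` to
  -- `L` is at most `Q↓(J - 1)`.
  have hv1 : ∀ i, i < j → weightV Q L ε (j + 1) ≤ decr Q (i + 1) := by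
    intro i hi
    obtain ⟨m, rfl⟩ : ∃ m, j = m + 1 := ⟨j - 1, by omega⟩
    have hm : ¬ decr Q (m + 1) < weightV Q L ε (m + 1) :=
      not_lt.2 (weightV_le_decr_of_lt Q (by omega) (by omega))
    rw [decr_lt_weightV_iff Q (by omega), not_lt] at hm
    refine le_trans ?_ (hq (show i ≤ m by omega))
    rw [weightV_of_lt Q hjL, div_le_iff₀ hjL', Finset.sum_range_succ]
    push_cast
    linarith
  have hv2 : decr Q (j + 1) ≤ weightV Q L ε (j + 1) := by
    rw [hj] at h2
    exact h2.le
  rcases eq_or_ne (indexK Q L ε) ⊤ with hK | hK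
  · refine isLeastMajorant_of_infinite hq hq0 hjL hp1 hp2 ?_ hv1 hv2 hv ?_
    · intro i hi
      rw [fanoType1, if_neg, if_neg, hK, weightW, if_pos rfl]
      · rw [Nat.succPNat_coe]; omega
      · rw [Nat.succPNat_coe, hj, hK]
        simp
        omega
    · refine le_antisymm (by linarith) ?_
      -- `K = ∞` forces `ε = 0`. For arbitrarily large `k` the criterion holds, and bounding the
      -- terms in `(m, k]` below by `Q↓(k)` leaves `∑_{x ≤ m} Q↓(x) - (m - L) Q↓(k) < 1 - ε`. Let `k
      -- → ∞`, so `Q↓(k) → 0`, and then `m → ∞`.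
      have hfreq : ∀ m, L ≤ m → ∑ i ∈ Finset.range m, decr Q (i + 1) ≤ 1 - ε := by
        intro m hm
        have hlim : Filter.Tendsto (fun n => ∑ i ∈ Finset.range m, decr Q (i + 1)
            - ((m : ℝ) - L) * decr Q (n + 1)) Filter.atTop
            (nhds (∑ i ∈ Finset.range m, decr Q (i + 1) - ((m : ℝ) - L) * 0)) :=
          tendsto_const_nhds.sub (hq1.summable.tendsto_atTop_zero.const_mul _)
        rw [mul_zero, sub_zero] at hlim
        refine le_of_tendsto_of_frequently hlim (Filter.frequently_atTop.2 fun a => ?_)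
        have hlt : ((max a m + 1 : ℕ) : ℕ∞) < indexK Q L ε := by
          rw [hK]; exact ENat.natCast_lt_top _
        obtain ⟨_, ⟨k, rfl, hk, hkW⟩, hlt'⟩ := lt_sSup_iff.1 hlt
        have hk' : max a m + 1 < k := by exact_mod_cast hlt'
        obtain ⟨n, rfl⟩ : ∃ n, k = n + 1 := ⟨k - 1, by omega⟩
        refine ⟨n, by omega, ?_⟩
        have hmn : m ≤ n + 1 := by omega
        rw [weightW_lt_decr_iff Q (by omega), ← Finset.sum_range_add_sum_Ico _ hmn] at hkW
        have := Finset.card_nsmul_le_sum (Finset.Ico m (n + 1)) (fun i => decr Q (i + 1))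
          (decr Q (n + 1)) fun i hi =>
            decr_le_decr Q (by omega) (by have := (Finset.mem_Ico.1 hi).2; omega)
        rw [Nat.card_Ico, nsmul_eq_mul, Nat.cast_sub hmn] at this
        linarith
      exact le_of_tendsto hq1.tendsto_sum_nat
        ((Filter.eventually_ge_atTop L).mono hfreq)
  · have hmem : indexK Q L ε ∈
        {m : ℕ∞ | ∃ k : ℕ, m = (k : ℕ∞) ∧ L ≤ k ∧ weightW Q L ε (k : ℕ∞) < decr Q k} := by
      have : Nonempty {m : ℕ∞ | ∃ k : ℕ, m = (k : ℕ∞) ∧ L ≤ k ∧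
          weightW Q L ε (k : ℕ∞) < decr Q k} := ⟨⟨_, L, rfl, le_rfl, weightW_self_lt Q⟩⟩
      exact ENat.sSup_mem_of_nonempty_of_lt_top (lt_top_iff_ne_top.2 hK)
    obtain ⟨k, hk, -, hkW⟩ := hmem
    have hLk : L < k := by
      rw [hk] at hKL
      have : L + 1 ≤ k := by exact_mod_cast hKL
      omega
    have hLk' : (0 : ℝ) < (k : ℝ) - L := sub_pos.2 (by exact_mod_cast hLk)
    have hw : 1 - ε + ((k : ℝ) - L) * weightW Q L ε (k : ℕ∞)
        = ∑ i ∈ Finset.range k, decr Q (i + 1) := by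
      rw [weightW_of_lt Q hLk, mul_div_cancel₀ _ hLk'.ne']
      ring
    -- Maximality of `K`: failure at `K + 1` is equivalent to `Q↓(K + 1) ≤ W(K)`.
    have hkn : ¬ weightW Q L ε ((k + 1 : ℕ) : ℕ∞) < decr Q (k + 1) := by
      intro h
      have := le_indexK_of_mem Q (by omega) h
      rw [hk] at this
      have : k + 1 ≤ k := by exact_mod_cast this
      omega
    rw [weightW_lt_decr_iff Q (by omega), not_lt, Finset.sum_range_succ] at hkn
    push_cast at hkn
    refine isLeastMajorant_of_finite hq hq0 hq1 (k := k) (w := weightW Q L ε (k : ℕ∞))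
      hjL hLk hp1 hp2 ?_ ?_ hv1 hv2 ?_ ?_ hv hw
    · intro i hi hik
      rw [fanoType1, if_neg, if_neg, hk]
      · rw [Nat.succPNat_coe]; omega
      · rw [Nat.succPNat_coe, hj, hk, not_or, not_lt, not_lt]
        refine ⟨by omega, ?_⟩
        exact_mod_cast (by omega : i.succ ≤ k)
    · intro i hi
      rw [fanoType1, if_pos]
      · rfl
      · right
        rw [Nat.succPNat_coe, hk]
        exact_mod_cast (by omega : k < i.succ)
    · rw [show k - 1 + 1 = k by omega]
      exact hkW.le
    · rw [weightW_of_lt Q hLk, le_div_iff₀ hLk']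
      linarith

theorem tsum_pnat_eq_add_add (φ : ℕ+ → ℝ≥0∞) {A B C : ℕ+ → Prop}
    (h : ∀ x, (A x ∧ ¬ B x ∧ ¬ C x) ∨ (¬ A x ∧ B x ∧ ¬ C x) ∨ (¬ A x ∧ ¬ B x ∧ C x)) :
    ∑' x, φ x = ∑' x : {x // A x}, φ x + ∑' x : {x // B x}, φ x + ∑' x : {x // C x}, φ x := by
  classical
  have e : ∀ D : ℕ+ → Prop, ∑' x : {x // D x}, φ x = ∑' x, if D x then φ x else 0 := by
    intro D
    refine (tsum_subtype {x | D x} φ).trans (tsum_congr fun x => ?_)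
    rw [Set.indicator_apply]
    rfl
  rw [e, e, e, ← ENNReal.tsum_add, ← ENNReal.tsum_add]
  refine tsum_congr fun x => ?_
  rcases h x with ⟨h1, h2, h3⟩ | ⟨h1, h2, h3⟩ | ⟨h1, h2, h3⟩ <;> simp [h1, h2, h3]

theorem encard_pnat_Icc {a : ℕ} (ha : 1 ≤ a) (K : ℕ∞) :
    {x : ℕ+ | a ≤ (x : ℕ) ∧ ((x : ℕ) : ℕ∞) ≤ K}.encard = K + 1 - a := by
  rw [← PNat.coe_injective.encard_image]
  have himg : ∀ s : Set ℕ, (∀ n ∈ s, 1 ≤ n) →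
      ((↑) : ℕ+ → ℕ) '' {x : ℕ+ | (x : ℕ) ∈ s} = s := by
    intro s hs
    ext n
    constructor
    · rintro ⟨x, hx, rfl⟩
      exact hx
    · intro hn
      exact ⟨⟨n, hs n hn⟩, hn, rfl⟩
  induction K using ENat.recTopCoe with
  | top =>
    have := himg (Set.Ici a) fun n hn => ha.trans hn
    simp only [le_top, and_true]
    rw [show {x : ℕ+ | a ≤ (x : ℕ)} = {x : ℕ+ | (x : ℕ) ∈ Set.Ici a} from rfl, this,
      (Set.Ici_infinite a).encard_eq]
    simp
  | coe k =>
    have := himg (Finset.Icc a k : Set ℕ) fun n hn => by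
      simp at hn
      omega
    rw [show {x : ℕ+ | a ≤ (x : ℕ) ∧ ((x : ℕ) : ℕ∞) ≤ (k : ℕ∞)}
        = {x : ℕ+ | (x : ℕ) ∈ (Finset.Icc a k : Set ℕ)} by ext x; simp, this,
      Set.encard_coe_eq_coe_finsetCard, Nat.card_Icc]
    norm_cast

theorem add_one_tsub_natCast_succ (K : ℕ∞) (n : ℕ) : K + 1 - ((n + 1 : ℕ) : ℕ∞) = K - n := by
  induction K using ENat.recTopCoe with
  | top => simp
  | coe k =>
    norm_cast
    omega

/-- `J ≤ L + 1` makes the natural subtraction exact. For `K = L` the factor `0` removes the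
placeholder `W(L) = -1`; for `K = ∞` the `ℝ≥0∞` rule `⊤ * 0 = 0` supplies the stated convention. -/
theorem tsum_fanoType1 (hL : 1 ≤ L) (F : ℝ → ℝ≥0∞) :
    ∑' x, F (fanoType1 Q L ε x) =
      ((L + 1 - indexJ Q L ε : ℕ) : ℝ≥0∞) * F (weightV Q L ε (indexJ Q L ε))
        + ((indexK Q L ε - (L : ℕ∞) : ℕ∞) : ℝ≥0∞) * F (weightW Q L ε (indexK Q L ε))
        + ∑' x : {x : ℕ+ // (x : ℕ) < indexJ Q L ε ∨ indexK Q L ε < ((x : ℕ) : ℕ∞)},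
            F (decr Q (x : ℕ+)) := by
  have hJ1 := (indexJ_mem Q (ε := ε) hL).1
  have hJL := indexJ_le Q (ε := ε) hL
  have hK := le_indexK Q (L := L) (ε := ε)
  have hKx : ∀ x : ℕ+, (x : ℕ) ≤ L → ((x : ℕ) : ℕ∞) ≤ indexK Q L ε := fun x hx =>
    le_trans (by exact_mod_cast hx) hK
  rw [tsum_pnat_eq_add_add (fun x => F (fanoType1 Q L ε x))
    (A := fun x => indexJ Q L ε ≤ (x : ℕ) ∧ ((x : ℕ) : ℕ∞) ≤ (L : ℕ∞))
    (B := fun x => L + 1 ≤ (x : ℕ) ∧ ((x : ℕ) : ℕ∞) ≤ indexK Q L ε)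
    (C := fun x => (x : ℕ) < indexJ Q L ε ∨ indexK Q L ε < ((x : ℕ) : ℕ∞))]
  · congr 1
    · congr 1
      · calc _ = ∑' _ : {x : ℕ+ | indexJ Q L ε ≤ (x : ℕ) ∧ ((x : ℕ) : ℕ∞) ≤ (L : ℕ∞)},
              F (weightV Q L ε (indexJ Q L ε)) := by
              refine tsum_congr fun x => ?_
              have hx1 := x.2.1
              have hx2 : ((x : ℕ+) : ℕ) ≤ L := by exact_mod_cast x.2.2
              rw [fanoType1, if_neg, if_pos hx2]
              rw [not_or, not_lt, not_lt]
              exact ⟨hx1, hKx _ hx2⟩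
          _ = _ := by
              rw [ENNReal.tsum_set_const, encard_pnat_Icc hJ1]
              norm_cast
      · calc _ = ∑' _ : {x : ℕ+ | L + 1 ≤ (x : ℕ) ∧ ((x : ℕ) : ℕ∞) ≤ indexK Q L ε},
              F (weightW Q L ε (indexK Q L ε)) := by
              refine tsum_congr fun x => ?_
              have hx1 := x.2.1
              rw [fanoType1, if_neg, if_neg (by omega)]
              rw [not_or, not_lt, not_lt]
              exact ⟨by omega, x.2.2⟩
          _ = _ := by
              rw [ENNReal.tsum_set_const, encard_pnat_Icc (by omega)]
              congr 2
              exact add_one_tsub_natCast_succ _ _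
    · refine tsum_congr fun x => ?_
      rw [fanoType1, if_pos x.2]
  · intro x
    have h1 := hKx x
    simp only [Nat.cast_le]
    rcases lt_or_ge (x : ℕ) (indexJ Q L ε) with h | h
    · right; right
      refine ⟨by omega, ?_, Or.inl h⟩
      omega
    · rcases lt_or_ge (indexK Q L ε) ((x : ℕ) : ℕ∞) with h' | h'
      · right; right
        have : ¬ (x : ℕ) ≤ L := fun h2 => absurd (h1 h2) (not_le.2 h')
        exact ⟨fun h3 => this h3.2, fun h3 => absurd h3.2 (not_le.2 h'), Or.inr h'⟩
      · have hn : ¬ ((x : ℕ) < indexJ Q L ε ∨ indexK Q L ε < ((x : ℕ) : ℕ∞)) := by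
          rw [not_or, not_lt, not_lt]; exact ⟨h, h'⟩
        rcases le_or_gt (x : ℕ) L with h2 | h2
        · left
          exact ⟨⟨h, h2⟩, fun h3 => by omega, hn⟩
        · right; left
          exact ⟨fun h3 => by omega, ⟨h2, h'⟩, hn⟩

end FanoDistribution

/-! ### Jensen's inequality for powers -/

theorem rpow_lintegral_le_lintegral_rpow {Ω : Type*} [MeasurableSpace Ω] {μ : Measure Ω}
    [IsProbabilityMeasure μ] {f : Ω → ℝ≥0∞} (hf : Measurable f) {s : ℝ} (hs : 1 < s) :
    (∫⁻ ω, f ω ∂μ) ^ s ≤ ∫⁻ ω, f ω ^ s ∂μ := by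
  have hs0 : 0 < s := by linarith
  have h := ENNReal.lintegral_mul_le_Lp_mul_Lq μ (Real.HolderConjugate.conjExponent hs)
    hf.aemeasurable (aemeasurable_const (b := (1 : ℝ≥0∞)))
  simp only [Pi.mul_apply, mul_one, ENNReal.one_rpow, lintegral_const, measure_univ] at h
  calc (∫⁻ ω, f ω ∂μ) ^ s ≤ ((∫⁻ ω, f ω ^ s ∂μ) ^ (1 / s)) ^ s := ENNReal.rpow_le_rpow h hs0.le
    _ = _ := by rw [← ENNReal.rpow_mul, one_div_mul_cancel hs0.ne', ENNReal.rpow_one]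

/-! ### The averaged sorted conditional law -/

section Averaging

variable {Ω 𝒴 : Type*} [MeasurableSpace Ω] [MeasurableSpace 𝒴]

/-- The event that the `(n + 1)`-th largest mass exceeds `t` is a countable union over the sets of
`n + 1` letters whose masses could all exceed `t`. -/
theorem measurable_decr_toPMF (κ : Kernel 𝒴 ℕ+) [IsMarkovKernel κ] (n : ℕ) :
    Measurable fun y => decr (κ y).toPMF (n + 1) := by
  refine measurable_of_Ioi fun t => ?_
  rcases lt_or_ge t 0 with ht | ht
  · have : (fun y => decr (κ y).toPMF (n + 1)) ⁻¹' Set.Ioi t = Set.univ :=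
      Set.eq_univ_of_forall fun y => ht.trans_le (decr_nonneg _ _)
    rw [this]
    exact MeasurableSet.univ
  · have : (fun y => decr (κ y).toPMF (n + 1)) ⁻¹' Set.Ioi t
        = ⋃ S : {S : Finset ℕ+ // S.card = n + 1}, ⋂ x ∈ S.1, {y | t < (κ y {x}).toReal} := by
      ext y
      simp only [Set.mem_preimage, Set.mem_Ioi, Set.mem_iUnion, Set.mem_iInter]
      rw [lt_decr_iff _ ht (Nat.le_add_left 1 n)]
      constructor
      · intro h
        obtain ⟨S, hS, hcard⟩ := Set.exists_subset_encard_eq h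
        have hfin : S.Finite := Set.finite_of_encard_eq_coe hcard
        refine ⟨⟨hfin.toFinset, ?_⟩, fun x hx => hS (hfin.mem_toFinset.1 hx)⟩
        rw [hfin.encard_eq_coe_toFinset_card] at hcard
        exact_mod_cast hcard
      · rintro ⟨⟨S, hcard⟩, hS⟩
        rw [← hcard, ← Set.encard_coe_eq_coe_finsetCard]
        exact Set.encard_le_encard fun x hx => hS x hx
    rw [this]
    refine MeasurableSet.iUnion fun S => Finset.measurableSet_biInter _ fun x _ => ?_
    exact measurableSet_lt measurable_const
      (Kernel.measurable_coe κ (measurableSet_singleton x)).ennreal_toReal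

theorem measure_finset_le_sum_decr (ν : Measure ℕ+) [IsProbabilityMeasure ν] (S : Finset ℕ+)
    {k : ℕ} (hS : S.card ≤ k) :
    ν S ≤ ∑ n ∈ Finset.range k, ENNReal.ofReal (decr ν.toPMF (n + 1)) := by
  rw [← ENNReal.ofReal_sum_of_nonneg fun _ _ => decr_nonneg _ _]
  calc ν S = ∑ x ∈ S, ENNReal.ofReal (ν.toPMF x).toReal := by
        rw [← sum_measure_singleton]
        exact Finset.sum_congr rfl fun x _ => (ENNReal.ofReal_toReal (measure_ne_top ν _)).symm
    _ = ENNReal.ofReal (∑ x ∈ S, (ν.toPMF x).toReal) :=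
        (ENNReal.ofReal_sum_of_nonneg fun _ _ => ENNReal.toReal_nonneg).symm
    _ ≤ _ := ENNReal.ofReal_le_ofReal (sum_mass_le_sum_decr _ S hS)

variable (μ : Measure Ω) [IsProbabilityMeasure μ] {X : Ω → ℕ+} {Y : Ω → 𝒴}

/-- The `n`-th largest mass of the conditional law of `X` given `Y`, counted from `0`. -/
noncomputable def sortedCondLaw (X : Ω → ℕ+) (Y : Ω → 𝒴) (ω : Ω) (n : ℕ) : ℝ≥0∞ :=
  ENNReal.ofReal (decr (condDistrib X Y μ (Y ω)).toPMF (n + 1))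

theorem measurable_sortedCondLaw (hY : Measurable Y) (n : ℕ) :
    Measurable fun ω => sortedCondLaw μ X Y ω n :=
  ((measurable_decr_toPMF (condDistrib X Y μ) n).comp hY).ennreal_ofReal

theorem tsum_sortedCondLaw (ω : Ω) : ∑' n, sortedCondLaw μ X Y ω n = 1 := tsum_decr _

theorem powerSum_condLaw {α : ℝ} (hα : 0 < α) (ω : Ω) :
    powerSum α (condLaw μ X Y ω) = ∑' n, sortedCondLaw μ X Y ω n ^ α :=
  powerSum_mass (condDistrib X Y μ (Y ω)).toPMF hα

theorem shannon_condLaw (ω : Ω) :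
    shannon (condLaw μ X Y ω)
      = ∑' n, ENNReal.ofReal (Real.negMulLog (sortedCondLaw μ X Y ω n).toReal) := by
  refine (shannon_mass (condDistrib X Y μ (Y ω)).toPMF).trans (tsum_congr fun n => ?_)
  rw [sortedCondLaw, ENNReal.toReal_ofReal (decr_nonneg _ _)]

/-- Disintegrate over `Y` and bound the conditional probability of each list by the largest
conditional masses. It serves both constant lists and list decoders. -/
theorem measure_mem_list_le (hX : Measurable X) (hY : Measurable Y) {f : 𝒴 → Finset ℕ+}
    (hf : ∀ x, MeasurableSet {y | x ∈ f y}) {k : ℕ} (hk : ∀ y, (f y).card ≤ k) :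
    μ {ω | X ω ∈ f (Y ω)} ≤ ∑ n ∈ Finset.range k, ∫⁻ ω, sortedCondLaw μ X Y ω n ∂μ := by
  have hs : MeasurableSet {z : 𝒴 × ℕ+ | z.2 ∈ f z.1} := by
    have : {z : 𝒴 × ℕ+ | z.2 ∈ f z.1} = ⋃ x : ℕ+, {y | x ∈ f y} ×ˢ {x} := by
      ext ⟨y, x⟩
      simp
    rw [this]
    exact MeasurableSet.iUnion fun x => (hf x).prod (measurableSet_singleton x)
  calc μ {ω | X ω ∈ f (Y ω)}
      = (μ.map fun ω => (Y ω, X ω)) {z : 𝒴 × ℕ+ | z.2 ∈ f z.1} :=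
        (Measure.map_apply (hY.prodMk hX) hs).symm
    _ = ∫⁻ y, condDistrib X Y μ y (Prod.mk y ⁻¹' {z : 𝒴 × ℕ+ | z.2 ∈ f z.1}) ∂(μ.map Y) := by
        rw [← compProd_map_condDistrib hX.aemeasurable, Measure.compProd_apply hs]
    _ ≤ ∫⁻ y, ∑ n ∈ Finset.range k,
          ENNReal.ofReal (decr (condDistrib X Y μ y).toPMF (n + 1)) ∂(μ.map Y) :=
        lintegral_mono fun y => measure_finset_le_sum_decr _ (f y) (hk y)
    _ = ∑ n ∈ Finset.range k, ∫⁻ y,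
          ENNReal.ofReal (decr (condDistrib X Y μ y).toPMF (n + 1)) ∂(μ.map Y) :=
        lintegral_finsetSum _ fun n _ => (measurable_decr_toPMF _ n).ennreal_ofReal
    _ = _ := Finset.sum_congr rfl fun n _ =>
        lintegral_map (measurable_decr_toPMF _ n).ennreal_ofReal hY

theorem lintegral_sortedCondLaw_ne_top (n : ℕ) :
    ∫⁻ ω, sortedCondLaw μ X Y ω n ∂μ ≠ ⊤ := by
  refine ne_top_of_le_ne_top ENNReal.one_ne_top ?_
  calc ∫⁻ ω, sortedCondLaw μ X Y ω n ∂μ ≤ ∫⁻ _, 1 ∂μ := lintegral_mono fun ω => by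
        rw [← tsum_sortedCondLaw μ (X := X) (Y := Y) ω]
        exact ENNReal.le_tsum n
    _ = 1 := by simp

theorem real_mem_list_le (hX : Measurable X) (hY : Measurable Y) {f : 𝒴 → Finset ℕ+}
    (hf : ∀ x, MeasurableSet {y | x ∈ f y}) {k : ℕ} (hk : ∀ y, (f y).card ≤ k) :
    μ.real {ω | X ω ∈ f (Y ω)}
      ≤ ∑ n ∈ Finset.range k, (∫⁻ ω, sortedCondLaw μ X Y ω n ∂μ).toReal := by
  rw [← ENNReal.toReal_sum fun n _ => lintegral_sortedCondLaw_ne_top μ n]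
  exact ENNReal.toReal_mono
    (ENNReal.sum_ne_top.2 fun n _ => lintegral_sortedCondLaw_ne_top μ n)
    (measure_mem_list_le μ hX hY hf hk)

/-- Use the constant list of at most `k` most likely letters under `Q`. -/
theorem sum_decr_le_sum_lintegral (hX : Measurable X) (hY : Measurable Y) {Q : PMF ℕ+}
    (hQ : μ.map X = Q.toMeasure) (k : ℕ) :
    ∑ i ∈ Finset.range k, decr Q (i + 1)
      ≤ ∑ n ∈ Finset.range k, (∫⁻ ω, sortedCondLaw μ X Y ω n ∂μ).toReal := by
  obtain ⟨S, hS, hsum⟩ := exists_sum_mass_eq_sum_decr Q k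
  rw [← hsum]
  refine le_trans (le_of_eq ?_) (real_mem_list_le μ hX hY (f := fun _ => S)
    (fun x => MeasurableSet.const _) fun _ => hS)
  have h1 : μ {ω | X ω ∈ S} = ∑ x ∈ S, Q x := by
    rw [← Q.toMeasure_apply_finset, ← hQ, Measure.map_apply hX (Finset.measurableSet S)]
    rfl
  rw [Measure.real, h1, ENNReal.toReal_sum fun x _ => Q.apply_ne_top x]

theorem one_sub_listError_le (hX : Measurable X) (hY : Measurable Y) {L : ℕ} (hL : 1 ≤ L) :
    1 - listError L μ X Y
      ≤ ∑ n ∈ Finset.range L, (∫⁻ ω, sortedCondLaw μ X Y ω n ∂μ).toReal := by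
  rw [sub_le_comm]
  refine le_csInf ⟨_, fun _ => {1}, ⟨fun y => by simpa using hL, fun x => MeasurableSet.const _⟩,
    rfl⟩ ?_
  rintro _ ⟨f, ⟨hcard, hf⟩, rfl⟩
  have hm : MeasurableSet {ω | X ω ∈ f (Y ω)} := by
    have : {ω | X ω ∈ f (Y ω)} = ⋃ x : ℕ+, X ⁻¹' {x} ∩ Y ⁻¹' {y | x ∈ f y} := by
      ext ω
      simp
    rw [this]
    exact MeasurableSet.iUnion fun x => (hX (measurableSet_singleton x)).inter (hY (hf x))
  have h := real_mem_list_le μ hX hY hf fun y => (hcard y).2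
  have hc : μ.real {ω | X ω ∉ f (Y ω)} = 1 - μ.real {ω | X ω ∈ f (Y ω)} :=
    probReal_compl_eq_one_sub hm
  rw [hc]
  linarith

end Averaging

/-! ### The Fano inequality and its case of list size one -/

section FanoInequality

theorem tsum_pnat_eq_tsum_succPNat (φ : ℕ+ → ℝ≥0∞) : ∑' x, φ x = ∑' i : ℕ, φ i.succPNat :=
  (Equiv.pnatEquivNat.symm.tsum_eq φ).symm

variable {Ω 𝒴 : Type*} [MeasurableSpace Ω] [MeasurableSpace 𝒴]
  (μ : Measure Ω) [IsProbabilityMeasure μ] {X : Ω → ℕ+} {Y : Ω → 𝒴} {Q : PMF ℕ+} {L : ℕ} {ε : ℝ}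

/-- Arimoto's entropy is `(1 / (1 - α)) log (𝔼[N]^α)` and Hayashi's `(1 / (1 - α)) log 𝔼[N^α]`, with
`N` the conditional norm. Jensen's inequality and the sign of the prefactor both reverse at `α = 1`.
-/
theorem condRenyi_hayashi_le_arimoto (hY : Measurable Y) {α : ℝ} (hα : 0 < α) :
    condRenyi Kind.hayashi α μ X Y ≤ condRenyi Kind.arimoto α μ X Y := by
  by_cases h1 : α = 1
  · simp [condRenyi, h1]
  have hm : Measurable fun ω => alphaNorm α (condLaw μ X Y ω) := by
    simp only [alphaNorm, powerSum_condLaw μ hα]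
    exact (Measurable.tsum fun n => (measurable_sortedCondLaw μ hY n).pow_const _).pow_const _
  have hlog : ((α / (1 - α) : ℝ) : EReal)
        * ENNReal.log (∫⁻ ω, alphaNorm α (condLaw μ X Y ω) ∂μ)
      = ((1 / (1 - α) : ℝ) : EReal)
        * ENNReal.log ((∫⁻ ω, alphaNorm α (condLaw μ X Y ω) ∂μ) ^ α) := by
    rw [ENNReal.log_rpow, ← mul_assoc, ← EReal.coe_mul]
    congr 2
    ring
  simp only [condRenyi, if_neg h1, hlog]
  rcases lt_or_gt_of_ne h1 with h | h
  · refine mul_le_mul_of_nonneg_left (ENNReal.log_le_log ?_) ?_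
    · have := rpow_lintegral_le_lintegral_rpow (μ := μ) (hm.pow_const α)
        ((one_lt_div hα).2 h)
      simp only [← ENNReal.rpow_mul, mul_one_div_cancel hα.ne', ENNReal.rpow_one] at this
      have h2 := ENNReal.rpow_le_rpow this hα.le
      rwa [← ENNReal.rpow_mul, one_div_mul_cancel hα.ne', ENNReal.rpow_one] at h2
    · have : (0 : ℝ) ≤ 1 / (1 - α) := by
        have : 0 < 1 - α := by linarith
        positivity
      exact_mod_cast this
  · rw [mul_comm, mul_comm (((1 / (1 - α) : ℝ)) : EReal)]
    refine EReal.mul_le_mul_of_nonpos_right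
      (ENNReal.log_le_log (rpow_lintegral_le_lintegral_rpow hm h)) ?_
    have : 1 / (1 - α) ≤ (0 : ℝ) := one_div_nonpos.2 (by linarith)
    exact_mod_cast this

theorem condRenyi_le_renyi_fanoType1 (hL : 1 ≤ L)
    (hc : ∑ i ∈ Finset.range L, decr Q (i + 1) ≤ 1 - ε) (hε : 0 ≤ ε)
    (hX : Measurable X) (hY : Measurable Y) (herr : listError L μ X Y ≤ ε)
    (hQ : μ.map X = Q.toMeasure) (kind : Kind) {α : ℝ} (hα : 0 < α) :
    condRenyi kind α μ X Y ≤ renyi α (fanoType1 Q L ε) := by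
  suffices h : condRenyi Kind.arimoto α μ X Y ≤ renyi α (fanoType1 Q L ε) by
    cases kind
    · exact h
    · exact (condRenyi_hayashi_le_arimoto μ hY hα).trans h
  have hP := isLeastMajorant_fanoType1 Q hL hc hε
  set r : ℕ → ℝ≥0∞ := fun i => ENNReal.ofReal (fanoType1 Q L ε i.succPNat) with hr
  have hr1 : ∑' n, r n = 1 := by
    rw [hr, ← ENNReal.ofReal_tsum_of_nonneg hP.nonneg hP.hasSum.summable, hP.hasSum.tsum_eq,
      ENNReal.ofReal_one]
  have hanti : Antitone r := fun m n hmn => ENNReal.ofReal_le_ofReal (hP.antitone hmn)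
  have hpm : ∀ n, Measurable fun ω => sortedCondLaw μ X Y ω n := measurable_sortedCondLaw μ hY
  have hp : ∀ ω, ∑' n, sortedCondLaw μ X Y ω n = 1 := tsum_sortedCondLaw μ
  have hmaj : ∀ k, ∑ n ∈ Finset.range k, r n
      ≤ ∑ n ∈ Finset.range k, ∫⁻ ω, sortedCondLaw μ X Y ω n ∂μ := by
    intro k
    have h := hP.sum_range_le (fun n => (∫⁻ ω, sortedCondLaw μ X Y ω n ∂μ).toReal)
      (fun m n hmn => ENNReal.toReal_mono (lintegral_sortedCondLaw_ne_top μ m)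
        (lintegral_mono fun ω => ENNReal.ofReal_le_ofReal (antitone_decr_succ _ hmn)))
      (fun _ => ENNReal.toReal_nonneg) (sum_decr_le_sum_lintegral μ hX hY hQ)
      (le_trans (by linarith) (one_sub_listError_le μ hX hY hL)) k
    rw [hr, ← ENNReal.ofReal_sum_of_nonneg fun i _ => hP.nonneg i]
    refine (ENNReal.ofReal_le_ofReal h).trans (le_of_eq ?_)
    rw [← ENNReal.toReal_sum fun n _ => lintegral_sortedCondLaw_ne_top μ n, ENNReal.ofReal_toReal]
    exact ENNReal.sum_ne_top.2 fun n _ => lintegral_sortedCondLaw_ne_top μ n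
  by_cases h1 : α = 1
  · simp only [condRenyi, renyi, if_pos h1, condShannon, shannon_condLaw]
    have h := lintegral_negMulLog_le hpm hp hr1 hanti hmaj
    have e : shannon (fanoType1 Q L ε)
        = ∑' n, ENNReal.ofReal (Real.negMulLog (r n).toReal) := by
      rw [shannon, tsum_pnat_eq_tsum_succPNat]
      refine tsum_congr fun n => ?_
      rw [hr, ENNReal.toReal_ofReal (hP.nonneg n)]
    rw [e]
    exact_mod_cast h
  · have e : powerSum α (fanoType1 Q L ε) = ∑' n, r n ^ α :=
      tsum_pnat_eq_tsum_succPNat fun x => ENNReal.ofReal (fanoType1 Q L ε x) ^ α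
    have hlog : ((1 / (1 - α) : ℝ) : EReal) * ENNReal.log (∑' n, r n ^ α)
        = ((α / (1 - α) : ℝ) : EReal) * ENNReal.log ((∑' n, r n ^ α) ^ (1 / α)) := by
      rw [ENNReal.log_rpow, ← mul_assoc, ← EReal.coe_mul]
      congr 2
      field_simp
    simp only [condRenyi, renyi, if_neg h1, alphaNorm, powerSum_condLaw μ hα, e, hlog]
    rcases lt_or_gt_of_ne h1 with h | h
    · refine mul_le_mul_of_nonneg_left (ENNReal.log_le_log
        (lintegral_norm_le_of_lt_one hα h hpm hp hr1 hanti hmaj)) ?_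
      have : (0 : ℝ) ≤ α / (1 - α) := div_nonneg hα.le (by linarith)
      exact_mod_cast this
    · rw [mul_comm, mul_comm (((α / (1 - α) : ℝ)) : EReal)]
      refine EReal.mul_le_mul_of_nonpos_right (ENNReal.log_le_log
        (norm_le_lintegral_of_one_lt h hpm hp hr1 hanti hmaj)) ?_
      have : α / (1 - α) ≤ (0 : ℝ) := div_nonpos_of_nonneg_of_nonpos hα.le (by linarith)
      exact_mod_cast this

/-- For `L = 1` the least-majorant property fixes the first mass at `1 - ε`, whether `J` is `1` or
`2`, so `J` disappears from the formula. -/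
theorem shannon_fanoType1_list_one (hc : ∑ i ∈ Finset.range 1, decr Q (i + 1) ≤ 1 - ε)
    (hε : 0 ≤ ε) :
    shannon (fanoType1 Q 1 ε) = ENNReal.ofReal (Real.negMulLog (1 - ε))
      + ((indexK Q 1 ε - 1 : ℕ∞) : ℝ≥0∞)
        * ENNReal.ofReal (Real.negMulLog (weightW Q 1 ε (indexK Q 1 ε)))
      + ∑' x : {x : ℕ+ // indexK Q 1 ε < ((x : ℕ) : ℕ∞)},
          ENNReal.ofReal (Real.negMulLog (decr Q (x : ℕ+))) := by
  have hP := isLeastMajorant_fanoType1 Q le_rfl hc hε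
  have h1 : fanoType1 Q 1 ε 1 = 1 - ε :=
    (Finset.sum_range_one fun i => fanoType1 Q 1 ε i.succPNat).symm.trans hP.sum_range
  have hJL := indexJ_le Q (ε := ε) le_rfl
  have hK : (1 : ℕ∞) ≤ indexK Q 1 ε := by simpa using le_indexK Q (L := 1) (ε := ε)
  rw [shannon, tsum_pnat_eq_add_add (A := fun x => x = 1)
    (B := fun x => 1 + 1 ≤ (x : ℕ) ∧ ((x : ℕ) : ℕ∞) ≤ indexK Q 1 ε)
    (C := fun x => indexK Q 1 ε < ((x : ℕ) : ℕ∞))]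
  · congr 1
    · congr 1
      · rw [tsum_eq_single (⟨1, rfl⟩ : {x : ℕ+ // x = 1}) fun x hx => absurd (Subtype.ext x.2) hx,
          h1]
      · calc _ = ∑' _ : {x : ℕ+ | 1 + 1 ≤ (x : ℕ) ∧ ((x : ℕ) : ℕ∞) ≤ indexK Q 1 ε},
              ENNReal.ofReal (Real.negMulLog (weightW Q 1 ε (indexK Q 1 ε))) := by
              refine tsum_congr fun x => ?_
              have hx1 := x.2.1
              rw [fanoType1, if_neg, if_neg (by omega)]
              rw [not_or, not_lt, not_lt]
              exact ⟨by omega, x.2.2⟩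
          _ = _ := by
              rw [ENNReal.tsum_set_const, encard_pnat_Icc (by omega), add_one_tsub_natCast_succ]
              simp
    · refine tsum_congr fun x => ?_
      rw [fanoType1, if_pos (Or.inr x.2)]
  · intro x
    rcases eq_or_ne x 1 with rfl | hx
    · left
      exact ⟨rfl, by simp, not_lt.2 (by exact_mod_cast hK)⟩
    · have hx2 : 1 + 1 ≤ (x : ℕ) := by
        have := x.pos
        have : (x : ℕ) ≠ 1 := fun h => hx (PNat.coe_eq_one_iff.1 h)
        omega
      right
      rcases lt_or_ge (indexK Q 1 ε) ((x : ℕ) : ℕ∞) with h | h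
      · exact Or.inr ⟨hx, fun h' => absurd h'.2 (not_le.2 h), h⟩
      · exact Or.inl ⟨hx, ⟨hx2, h⟩, not_lt.2 h⟩

theorem listError_one_le (ν : Measure Ω) {Y : Ω → ℕ+} (h : ν.real {ω | X ω ≠ Y ω} ≤ ε) :
    listError 1 ν X Y ≤ ε := by
  have hmem : ν.real {ω | X ω ≠ Y ω} ∈ {p : ℝ | ∃ f : ℕ+ → Finset ℕ+,
      IsListDecoder 1 f ∧ p = ν.real {ω | X ω ∉ f (Y ω)}} :=
    -- An estimate of `X` is the decoder returning the singleton list.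
    ⟨fun y => {y}, ⟨fun y => by simp, fun x => MeasurableSet.of_discrete⟩, by simp⟩
  refine (csInf_le ⟨0, ?_⟩ hmem).trans h
  rintro _ ⟨f, -, rfl⟩
  exact measureReal_nonneg

/-- The lower bound on `ε` enters the inequality through `ε ≥ 0`: the masses kept in the sum total
at most `1`. -/
theorem error_nonneg_of_tsum_le {p : ℕ+ → Prop}
    (h : 1 - ∑' x : {x : ℕ+ // p x}, decr Q (x : ℕ+) ≤ ε) : 0 ≤ ε := by
  have hs : HasSum (fun x : ℕ+ => decr Q x) 1 :=
    (Equiv.pnatEquivNat.symm.hasSum_iff (f := fun x : ℕ+ => decr Q x)).1 (hasSum_decr Q)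
  have := hs.summable.tsum_subtype_le (fun x : ℕ+ => decr Q x) {x | p x} fun x => decr_nonneg Q x
  rw [hs.tsum_eq] at this
  change ∑' x : {x : ℕ+ // p x}, decr Q (x : ℕ+) ≤ 1 at this
  linarith

end FanoInequality

end FanoRenyi

/-! ### The main theorem -/

open FanoRenyi in
theorem corollary1 {Ω 𝒴 : Type*} [MeasurableSpace Ω] [MeasurableSpace 𝒴]
    (μ : Measure Ω) [IsProbabilityMeasure μ]
    (Q : PMF ℕ+) (L : ℕ) (hL : 1 ≤ L) (ε : ℝ)
    (hε_lower :
      1 - ∑' x : {x : ℕ+ // ((x : ℕ) : ℕ∞) ≤ ENat.card 𝒴 * (L : ℕ∞)}, decr Q (x : ℕ+) ≤ ε)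
    (hε_upper : ε ≤ 1 - ∑ x ∈ Finset.Icc 1 L, decr Q x) :
    -- the Fano-distribution of type 1 is a probability distribution
    ((∀ x, 0 ≤ fanoType1 Q L ε x) ∧ HasSum (fanoType1 Q L ε) 1) ∧
    -- the Fano-type inequality, for Arimoto's and for Hayashi's entropy
    (∀ (kind : Kind) (α : ℝ), 0 < α →
      (⨆ (X : Ω → ℕ+) (Y : Ω → 𝒴) (_ : Measurable X) (_ : Measurable Y)
        (_ : listError L μ X Y ≤ ε) (_ : μ.map X = Q.toMeasure), condRenyi kind α μ X Y)
        ≤ renyi α (fanoType1 Q L ε)) ∧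
    -- the explicit value of the bound
    (∀ α : ℝ, 0 < α → α ≠ 1 →
      renyi α (fanoType1 Q L ε) =
        ((1 / (1 - α) : ℝ) : EReal) * ENNReal.log
          (((L + 1 - indexJ Q L ε : ℕ) : ℝ≥0∞)
              * ENNReal.ofReal (weightV Q L ε (indexJ Q L ε)) ^ α
            + ((indexK Q L ε - (L : ℕ∞) : ℕ∞) : ℝ≥0∞)
              * ENNReal.ofReal (weightW Q L ε (indexK Q L ε)) ^ α
            + ∑' x : {x : ℕ+ // (x : ℕ) < indexJ Q L ε ∨ indexK Q L ε < ((x : ℕ) : ℕ∞)},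
                ENNReal.ofReal (decr Q (x : ℕ+)) ^ α)) ∧
    (renyi 1 (fanoType1 Q L ε) =
        ((((L + 1 - indexJ Q L ε : ℕ) : ℝ≥0∞)
              * ENNReal.ofReal (Real.negMulLog (weightV Q L ε (indexJ Q L ε)))
            + ((indexK Q L ε - (L : ℕ∞) : ℕ∞) : ℝ≥0∞)
              * ENNReal.ofReal (Real.negMulLog (weightW Q L ε (indexK Q L ε)))
            + ∑' x : {x : ℕ+ // (x : ℕ) < indexJ Q L ε ∨ indexK Q L ε < ((x : ℕ) : ℕ∞)},
                ENNReal.ofReal (Real.negMulLog (decr Q (x : ℕ+))) : ℝ≥0∞) : EReal)) ∧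
    -- the case `α = 1`, `L = 1`: the Ho–Verdú–Fano inequality
    (L = 1 →
      (⨆ (X : Ω → ℕ+) (Y : Ω → ℕ+) (_ : Measurable X) (_ : Measurable Y)
        (_ : μ.real {ω | X ω ≠ Y ω} ≤ ε) (_ : μ.map X = Q.toMeasure), condShannon μ X Y)
        ≤ ENNReal.ofReal (Real.negMulLog (1 - ε))
          + ((indexK Q 1 ε - 1 : ℕ∞) : ℝ≥0∞)
            * ENNReal.ofReal (Real.negMulLog (weightW Q 1 ε (indexK Q 1 ε)))
          + ∑' x : {x : ℕ+ // indexK Q 1 ε < ((x : ℕ) : ℕ∞)},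
              ENNReal.ofReal (Real.negMulLog (decr Q (x : ℕ+)))) := by
  have hε : 0 ≤ ε := error_nonneg_of_tsum_le hε_lower
  have hc : ∑ i ∈ Finset.range L, decr Q (i + 1) ≤ 1 - ε := by
    rw [← sum_Icc_decr]
    linarith
  have hP := isLeastMajorant_fanoType1 Q hL hc hε
  refine ⟨⟨fun x => ?_, ?_⟩, fun kind α hα => ?_, fun α hα hα1 => ?_, ?_, ?_⟩
  · simpa using hP.nonneg x.natPred
  · exact (Equiv.pnatEquivNat.symm.hasSum_iff (f := fanoType1 Q L ε)).1 hP.hasSum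
  · exact iSup_le fun X => iSup_le fun Y => iSup_le fun hX => iSup_le fun hY => iSup_le fun herr =>
      iSup_le fun hQ => condRenyi_le_renyi_fanoType1 μ hL hc hε hX hY herr hQ kind hα
  · rw [renyi, if_neg hα1, powerSum, tsum_fanoType1 Q hL fun u => ENNReal.ofReal u ^ α]
  · rw [renyi, if_pos rfl, shannon,
      tsum_fanoType1 Q hL fun u => ENNReal.ofReal (Real.negMulLog u)]
  · rintro rfl
    rw [← shannon_fanoType1_list_one hc hε]
    refine iSup_le fun X => iSup_le fun Y => iSup_le fun hX => iSup_le fun hY =>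
      iSup_le fun herr => iSup_le fun hQ => ?_
    have h := condRenyi_le_renyi_fanoType1 μ hL hc hε hX hY (listError_one_le μ herr) hQ
      Kind.arimoto one_pos
    rw [condRenyi, renyi, if_pos rfl, if_pos rfl] at h
    exact_mod_cast h
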